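/- For sets $K,L\subseteq\mathbb R^n$ let $\mathrm{dist}_{\mathrm G}(K,L)=\Pr_{x\sim N(0,I_n)}[x\in K\,\triangle\,L]$ be their Gaussian distance. A halfspace is a set $\{x\in\mathbb R^n:\langle x,v\rangle\le\theta\}$ with $\|v\|_2=1$ and $\theta\in\mathbb R$; an intersection of $M$ halfspaces is said to have $M$ facets. Let $B_2=\{x\in\mathbb R^n:\|x\|_2\le\sqrt n\}$ be the $\ell_2$ ball of radius $\sqrt n$ and $B_1=\{x\in\mathbb R^n:\|x\|_1\le\sqrt{2/\pi}\,n\}$ the cross-polytope. There is an absolute constant $\varepsilon>0$ such that the following hold. 1. There is an absolute constant $c>0$ such that for every $n\ge1$, every intersection $L$ of $M$ halfspaces in $\mathbb R^n$ with $\mathrm{dist}_{\mathrm G}(B_2,L)\le\varepsilon$ satisfies $M\ge 2^{c\sqrt n}$. 2. The same is true of the cross-polytope: there is an absolute constant $c>0$ such that for every $n\ge1$, every intersection $L$ of $M$ halfspaces in $\mathbb R^n$ with $\mathrm{dist}_{\mathrm G}(B_1,L)\le\varepsilon$ satisfies $M\ge 2^{c\sqrt n}$. 3. The bound for the $\ell_2$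 ball is tight up to the constant in the exponent: for every $\delta>0$ there is a constant $C>0$, depending only on $\delta$, such that for every $n\ge1$ some intersection $L$ of at most $2^{C\sqrt n}$ halfspaces in $\mathbb R^n$ satisfies $\mathrm{dist}_{\mathrm G}(B_2,L)\le\delta$. In particular, for every constant $0<\delta\le\varepsilon$ the minimum number of facets of an intersection of halfspaces at Gaussian distance at most $\delta$ from $B_2$ is $2^{\Theta(\sqrt n)}$. -/

import Mathlib

open MeasureTheory ProbabilityTheory

namespace GaussianApprox

/-- The Gaussian distance between `K` and `L`: the probability that a standard Gaussian vector
`x ~ N(0, I_n)` lies in the symmetric difference of `K` and `L`. -/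
noncomputable def distG {n : ℕ} (K L : Set (EuclideanSpace ℝ (Fin n))) : ℝ :=
  (stdGaussian (EuclideanSpace ℝ (Fin n))).real (symmDiff K L)

/-- A halfspace of `ℝⁿ`: a set `{x | ⟪x, v⟫ ≤ θ}` with `v` a unit vector and `θ` real. -/
def IsHalfspace {n : ℕ} (H : Set (EuclideanSpace ℝ (Fin n))) : Prop :=
  ∃ (v : EuclideanSpace ℝ (Fin n)) (θ : ℝ), ‖v‖ = 1 ∧ H = {x | inner ℝ x v ≤ θ}

/-- The class of all intersections of `M` halfspaces in `ℝⁿ`. -/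
def Facet (n M : ℕ) : Set (Set (EuclideanSpace ℝ (Fin n))) :=
  {L | ∃ H : Fin M → Set (EuclideanSpace ℝ (Fin n)), (∀ i, IsHalfspace (H i)) ∧ L = ⋂ i, H i}

/-- The `ℓ₂` ball `B₂ = B(√n)`: the Euclidean ball of radius `√n` centred at the origin. -/
noncomputable def ball2 (n : ℕ) : Set (EuclideanSpace ℝ (Fin n)) :=
  {x | ‖x‖ ≤ Real.sqrt n}

/-- The cross-polytope `B₁ = {x | ‖x‖₁ ≤ √(2/π) n}`. -/
noncomputable def ball1 (n : ℕ) : Set (EuclideanSpace ℝ (Fin n)) :=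
  {x | ∑ i, |x i| ≤ Real.sqrt (2 / Real.pi) * n}

end GaussianApprox

/-!
Throughout, `γ` is the standard Gaussian measure on `ℝⁿ`.

**Lower bounds.** Both bodies have the form `K = {x | ∑ f(x_i) ≤ 0}` with `f` even and centred under
`N(0, 1)`. By the central limit theorem `γ(Kᶜ)` is bounded away from `0` uniformly in `n`
(`exists_le_stdGaussian_sum_pos`), while by Chebyshev's inequality the dilate `t K` with
`t = exp (R / √n)` and `R` a large constant has almost full measure. So dilation by `t` gains a
constant amount of mass for `K`, and hence also for every `L` that is close enough to `K`, since
such a dilation distorts `γ` only by a bounded factor off a set of small measure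
(`exists_stdGaussian_dilate_le`). For an intersection of `M` halfspaces, on the other hand, facets at
distance more than `T ≈ √(2 log M)` from the origin are negligible, and the others move by at most
`O(T / √n)`. A point of `t L \ L` therefore has `max (⟪x, v i⟫ - θ i)` in an interval of length
`O(T / √n)`, and this has probability `O(T² / √n)` by the anti-concentration of maxima of Gaussians
(`stdGaussian_max_anticoncentration`), a finite-difference form of Nazarov's bound on Gaussian
surface area. Hence `log M ≳ T² ≳ √n` (`facet_lower_bound`). The cases `M ≤ 1` are excluded by
symmetry (`two_le_of_mem_facet`).

**Upper bound.** A random halfspace `{x | ⟪x, v⟫ ≤ θ}` with `v` standard Gaussian and `θ` of order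
`n ^ (3 / 4)` cuts off a point of norm `r` with probability `P(N > θ / r)`, which grows by a large
constant factor as `r` crosses a thin shell around `√n`. With `M` the reciprocal of this probability
(up to a constant), that is `M = 2 ^ O(√n)`, the intersection of `M` independent such halfspaces
contains most of the points inside the shell and few of those outside
(`exists_facet_distG_ball2_le`); the shell itself is negligible (`stdGaussian_shell_le`).

All comparisons of measures rest on two exact formulas for the mass of a translate and of a dilate
(`stdGaussian_translate`, `stdGaussian_dilate`).
-/

namespace GaussianApprox

/-! ### Density, translation and dilation of the standard Gaussian measure -/

section Density

variable {E : Type*} [NormedAddCommGroup E] [InnerProductSpace ℝ E]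

/-- The density `(2π)^(-d/2) exp(-‖x‖²/2)` of the standard Gaussian measure. -/
noncomputable def gaussDensity (x : E) : ℝ :=
  ((2 * Real.pi) ^ (Module.finrank ℝ E / 2 : ℝ))⁻¹ * Real.exp (-‖x‖ ^ 2 / 2)

lemma gaussDensity_pos (x : E) : 0 < gaussDensity x := by
  unfold gaussDensity; positivity

lemma continuous_gaussDensity : Continuous (gaussDensity (E := E)) := by
  unfold gaussDensity; fun_prop

variable [FiniteDimensional ℝ E] [MeasurableSpace E] [BorelSpace E]

lemma integrable_gaussDensity : Integrable (gaussDensity (E := E)) := by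
  have h := (GaussianFourier.integrable_cexp_neg_mul_sq_norm_add (V := E) (b := (1 / 2 : ℂ))
    (by norm_num) 0 0).norm
  refine (h.const_mul (((2 * Real.pi) ^ (Module.finrank ℝ E / 2 : ℝ))⁻¹)).congr
    (ae_of_all _ fun x => ?_)
  simp only [gaussDensity, Complex.norm_exp]
  congr 2
  simp [← Complex.ofReal_pow]
  ring

/-- The standard Gaussian measure has the density `gaussDensity`: both sides have the
characteristic function `exp(-‖t‖²/2)`. -/
theorem stdGaussian_eq_withDensity :
    stdGaussian E = volume.withDensity (fun x => ENNReal.ofReal (gaussDensity x)) := by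
  have hfin : IsFiniteMeasure (volume.withDensity (fun x : E => ENNReal.ofReal (gaussDensity x))) :=
    isFiniteMeasure_withDensity_ofReal integrable_gaussDensity.2
  apply Measure.ext_of_charFun
  ext t
  rw [charFun_stdGaussian, charFun_apply, integral_withDensity_eq_integral_toReal_smul
    (by have := continuous_gaussDensity (E := E); fun_prop)
    (ae_of_all _ fun _ => ENNReal.ofReal_lt_top)]
  have h := GaussianFourier.integral_cexp_neg_mul_sq_norm_add (V := E) (b := (1 / 2 : ℂ))
    (by norm_num) Complex.I t
  have e : ∀ x : E, (ENNReal.ofReal (gaussDensity x)).toReal •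
      Complex.exp ((inner ℝ x t : ℝ) * Complex.I) =
      ((((2 * Real.pi) ^ (Module.finrank ℝ E / 2 : ℝ))⁻¹ : ℝ) : ℂ) *
        Complex.exp (-(1 / 2 : ℂ) * ‖x‖ ^ 2 + Complex.I * (inner ℝ t x : ℝ)) := by
    intro x
    rw [ENNReal.toReal_ofReal (gaussDensity_pos x).le, gaussDensity, Complex.real_smul,
      Complex.ofReal_mul, Complex.ofReal_exp, mul_assoc, ← Complex.exp_add, real_inner_comm]
    congr 2
    push_cast
    ring
  simp_rw [e]
  rw [integral_const_mul, h]
  have hpi : (Real.pi / (1 / 2 : ℂ)) ^ (Module.finrank ℝ E / 2 : ℂ) =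
      (((2 * Real.pi) ^ (Module.finrank ℝ E / 2 : ℝ) : ℝ) : ℂ) := by
    rw [Complex.ofReal_cpow (by positivity)]
    push_cast
    congr 1
    ring
  rw [hpi, ← mul_assoc, ← Complex.ofReal_mul, inv_mul_cancel₀ (by positivity)]
  simp only [Complex.ofReal_one, one_mul, Complex.I_sq]
  congr 1
  ring

lemma stdGaussian_apply {A : Set E} (hA : MeasurableSet A) :
    stdGaussian E A = ∫⁻ x in A, ENNReal.ofReal (gaussDensity x) := by
  rw [stdGaussian_eq_withDensity, withDensity_apply _ hA]

lemma setLIntegral_stdGaussian {A : Set E} (hA : MeasurableSet A) {f : E → ENNReal}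
    (hf : Measurable f) :
    ∫⁻ x in A, f x ∂(stdGaussian E) = ∫⁻ x in A, ENNReal.ofReal (gaussDensity x) * f x := by
  have hc := continuous_gaussDensity (E := E)
  rw [stdGaussian_eq_withDensity,
    setLIntegral_withDensity_eq_setLIntegral_mul _ (by fun_prop) hf hA]
  rfl

instance : (stdGaussian E).IsOpenPosMeasure := by
  rw [stdGaussian_eq_withDensity]
  have hc := continuous_gaussDensity (E := E)
  refine ⟨fun U hU hne h => ?_⟩
  rw [withDensity_apply _ hU.measurableSet,
    setLIntegral_eq_zero_iff hU.measurableSet (by fun_prop)] at h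
  have : volume U = 0 := by
    rw [← nonpos_iff_eq_zero]
    refine (measure_mono_null ?_ (ae_iff.1 h)).le
    intro x hx
    simp [hx, gaussDensity_pos x]
  exact hU.measure_ne_zero _ hne this

/-- Cameron–Martin formula: the mass of a translate. -/
theorem stdGaussian_translate {A : Set E} (hA : MeasurableSet A) (w : E) :
    stdGaussian E {y | y - w ∈ A} =
      ∫⁻ x in A, ENNReal.ofReal (Real.exp (-inner ℝ x w - ‖w‖ ^ 2 / 2)) ∂(stdGaussian E) := by
  have hm : MeasurableSet {y | y - w ∈ A} := (measurable_id.sub_const w) hA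
  have hc := continuous_gaussDensity (E := E)
  rw [stdGaussian_apply hm, setLIntegral_stdGaussian hA (by fun_prop),
    ← lintegral_indicator hm, ← lintegral_indicator hA,
    ← lintegral_sub_right_eq_self (μ := volume) (A.indicator _) w]
  refine lintegral_congr fun y => ?_
  by_cases h : y - w ∈ A
  · rw [Set.indicator_of_mem h, Set.indicator_of_mem (show y ∈ {y | y - w ∈ A} from h),
      ← ENNReal.ofReal_mul (gaussDensity_pos _).le, gaussDensity, gaussDensity, mul_assoc,
      ← Real.exp_add]
    congr 3
    have := norm_sub_sq_real y w
    rw [inner_sub_left, real_inner_self_eq_norm_sq]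
    linarith
  · rw [Set.indicator_of_notMem h, Set.indicator_of_notMem (show y ∉ {y | y - w ∈ A} from h)]

/-- The mass of the dilate `e^s A`. -/
theorem stdGaussian_dilate {A : Set E} (hA : MeasurableSet A) (s : ℝ) :
    stdGaussian E {y | Real.exp (-s) • y ∈ A} =
      ∫⁻ x in A, ENNReal.ofReal
        (Real.exp (Module.finrank ℝ E * s - (Real.exp (2 * s) - 1) * ‖x‖ ^ 2 / 2))
        ∂(stdGaussian E) := by
  have hm : MeasurableSet {y : E | Real.exp (-s) • y ∈ A} :=
    (measurable_const_smul (Real.exp (-s))) hA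
  have hc := continuous_gaussDensity (E := E)
  have key := Measure.map_addHaar_smul (volume : Measure E) (Real.exp_pos s).ne'
  rw [stdGaussian_apply hm, setLIntegral_stdGaussian hA (by fun_prop),
    ← lintegral_indicator hm, ← lintegral_indicator hA]
  have h1 : ∀ f : E → ENNReal, Measurable f → ∫⁻ y, f y =
      ENNReal.ofReal (Real.exp (Module.finrank ℝ E * s)) * ∫⁻ x, f (Real.exp s • x) := by
    intro f hf
    rw [← lintegral_map hf (measurable_const_smul (Real.exp s)), key, lintegral_smul_measure,
      smul_eq_mul, ← mul_assoc, ← ENNReal.ofReal_mul (Real.exp_pos _).le,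
      abs_of_pos (by positivity), ← Real.exp_nat_mul, ← Real.exp_neg, ← Real.exp_add]
    simp
  rw [h1 _ ((by fun_prop : Measurable fun x : E => ENNReal.ofReal (gaussDensity x)).indicator hm),
    ← lintegral_const_mul' _ _ ENNReal.ofReal_ne_top]
  refine lintegral_congr fun x => ?_
  have hx : Real.exp (-s) • Real.exp s • x = x := by
    rw [smul_smul, ← Real.exp_add]; simp
  by_cases h : x ∈ A
  · rw [Set.indicator_of_mem h, Set.indicator_of_mem
        (show Real.exp s • x ∈ {y : E | Real.exp (-s) • y ∈ A} by simpa [hx] using h),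
      ← ENNReal.ofReal_mul (gaussDensity_pos _).le, ← ENNReal.ofReal_mul (Real.exp_pos _).le,
      gaussDensity, gaussDensity, mul_assoc, mul_left_comm, ← Real.exp_add, ← Real.exp_add]
    congr 3
    rw [norm_smul, Real.norm_eq_abs, Real.abs_exp, mul_pow, ← Real.exp_nat_mul]
    push_cast
    ring
  · rw [Set.indicator_of_notMem h, Set.indicator_of_notMem
        (show Real.exp s • x ∉ {y : E | Real.exp (-s) • y ∈ A} by simpa [hx] using h), mul_zero]

/-- The standard Gaussian measure is symmetric. -/
lemma stdGaussian_neg {A : Set E} (hA : MeasurableSet A) :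
    stdGaussian E {x | -x ∈ A} = stdGaussian E A := by
  conv_rhs => rw [← stdGaussian_map (LinearIsometryEquiv.neg ℝ : E ≃ₗᵢ[ℝ] E)]
  rw [Measure.map_apply (LinearIsometryEquiv.continuous _).measurable hA]
  rfl

end Density

/-! ### Sums of independent functions of the coordinates -/

open Filter Topology

instance : (gaussianReal 0 1).IsOpenPosMeasure :=
  (gaussianReal_absolutelyContinuous' 0 one_ne_zero).isOpenPosMeasure

/-- The law of `∑ f(x_i)` under the standard Gaussian measure can be computed in the first `n`
coordinates of an infinite product. -/
lemma stdGaussian_sum_eq_infinitePi {f : ℝ → ℝ} (hf : Continuous f) (n : ℕ) (s : Set ℝ)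
    (hs : MeasurableSet s) :
    stdGaussian (EuclideanSpace ℝ (Fin n)) {x | ∑ i, f (x i) ∈ s} =
      Measure.infinitePi (fun _ : ℕ => gaussianReal 0 1)
        {ω | ∑ k ∈ Finset.range n, f (ω k) ∈ s} := by
  have hind : iIndepFun (fun (i : ℕ) (ω : ℕ → ℝ) => ω i)
      (Measure.infinitePi (fun _ : ℕ => gaussianReal 0 1)) :=
    iIndepFun_infinitePi (X := fun _ x => x) (fun _ => measurable_id)
  have hind' := hind.precomp (g := (Fin.val : Fin n → ℕ)) Fin.val_injective
  rw [iIndepFun_iff_map_fun_eq_pi_map (fun i => (measurable_pi_apply _).aemeasurable)] at hind'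
  have hev : ∀ i : ℕ, Measure.map (fun ω : ℕ → ℝ => ω i)
      (Measure.infinitePi (fun _ : ℕ => gaussianReal 0 1)) = gaussianReal 0 1 :=
    fun i => Measure.infinitePi_map_eval _ i
  simp only [hev] at hind'
  have hm : MeasurableSet {x : EuclideanSpace ℝ (Fin n) | ∑ i, f (x i) ∈ s} :=
    (by fun_prop : Measurable fun x : EuclideanSpace ℝ (Fin n) => ∑ i, f (x i)) hs
  rw [← map_pi_eq_stdGaussian, Measure.map_apply (by fun_prop) hm, ← hind',
    Measure.map_apply (by fun_prop) (WithLp.measurable_toLp 2 _ hm)]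
  congr 1
  ext ω
  simp [Finset.sum_range]

/-- By the central limit theorem, a centred sum is positive with probability bounded below
uniformly in the number of summands. -/
theorem exists_le_stdGaussian_sum_pos {f : ℝ → ℝ} (hf : Continuous f)
    (hL : MemLp f 2 (gaussianReal 0 1)) (h0 : ∫ x, f x ∂(gaussianReal 0 1) = 0)
    (hpos : ∃ x, 0 < f x) :
    ∃ c : ℝ, 0 < c ∧ ∀ n : ℕ, 1 ≤ n →
      c ≤ (stdGaussian (EuclideanSpace ℝ (Fin n))).real {x | 0 < ∑ i, f (x i)} := by
  set P := Measure.infinitePi (fun _ : ℕ => gaussianReal 0 1) with hP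
  have hmp : ∀ i : ℕ, MeasurePreserving (fun ω : ℕ → ℝ => ω i) P (gaussianReal 0 1) :=
    fun i => ⟨by fun_prop, Measure.infinitePi_map_eval _ i⟩
  obtain ⟨x₀, hx₀⟩ := hpos
  have hopen : IsOpen {x | 0 < f x} := isOpen_lt continuous_const hf
  have hvar0 : Var[fun ω : ℕ → ℝ => f (ω 0); P] = Var[f; gaussianReal 0 1] :=
    (hmp 0).variance_fun_comp hf.aemeasurable
  have hmean0 : ∫ ω : ℕ → ℝ, f (ω 0) ∂P = 0 := by
    rw [← h0, ← (hmp 0).map_eq, integral_map (measurable_pi_apply _).aemeasurable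
      (hf.aestronglyMeasurable)]
  have hvar : Var[f; gaussianReal 0 1] ≠ 0 := by
    intro hv
    have h1 := ae_eq_integral_of_variance_eq_zero hL hv
    rw [h0] at h1
    refine hopen.measure_ne_zero (gaussianReal 0 1) ⟨x₀, hx₀⟩ (measure_mono_null ?_ (ae_iff.1 h1))
    intro x hx
    exact (ne_of_gt hx : f x ≠ 0)
  -- the limit law gives the half-line positive mass
  have hlim := tendstoInDistribution_inv_sqrt_mul_sum_sub (P := P)
    (X := fun i ω => f (ω i)) (Y := id)
    (P' := gaussianReal 0 Var[fun ω : ℕ → ℝ => f (ω 0); P].toNNReal)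
    ⟨by fun_prop, Measure.map_id⟩ (hL.comp_measurePreserving (hmp 0))
    (iIndepFun_infinitePi (X := fun _ x => f x) (fun _ => hf.measurable))
    (fun i => IdentDistrib.comp (u := f) ⟨(measurable_pi_apply _).aemeasurable,
      (measurable_pi_apply _).aemeasurable, by
      rw [(hmp i).map_eq, (hmp 0).map_eq]⟩ hf.measurable)
  have hlim2 := ProbabilityMeasure.le_liminf_measure_open_of_tendsto hlim.tendsto
    (isOpen_Ioi (a := (0 : ℝ)))
  simp only [ProbabilityMeasure.coe_mk, Measure.map_id] at hlim2
  have hv2 : Var[fun ω : ℕ → ℝ => f (ω 0); P].toNNReal ≠ 0 := by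
    rw [hvar0, Ne, Real.toNNReal_eq_zero, not_le]
    exact lt_of_le_of_ne (variance_nonneg _ _) hvar.symm
  have hposlim : 0 < gaussianReal 0 Var[fun ω : ℕ → ℝ => f (ω 0); P].toNNReal (Set.Ioi 0) := by
    have : (gaussianReal 0 Var[fun ω : ℕ → ℝ => f (ω 0); P].toNNReal).IsOpenPosMeasure :=
      (gaussianReal_absolutelyContinuous' 0 hv2).isOpenPosMeasure
    exact isOpen_Ioi.measure_pos _ ⟨1, by simp⟩
  obtain ⟨q, hq0, hq⟩ := exists_between hposlim
  have hev := eventually_lt_of_lt_liminf (lt_of_lt_of_le hq hlim2)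
  obtain ⟨N, hN⟩ := eventually_atTop.1 hev
  have hlarge : ∀ n, 1 ≤ n → N ≤ n →
      q ≤ stdGaussian (EuclideanSpace ℝ (Fin n)) {x | 0 < ∑ i, f (x i)} := by
    intro n hn1 hn
    have h2 := hN n hn
    have h3 := stdGaussian_sum_eq_infinitePi hf n (Set.Ioi 0) measurableSet_Ioi
    simp only [Set.mem_Ioi] at h3
    rw [h3]
    rw [Measure.map_apply (by fun_prop) measurableSet_Ioi] at h2
    refine h2.le.trans (measure_mono ?_)
    intro ω hω
    have hω' : 0 < (√(n : ℝ))⁻¹ * (∑ k ∈ Finset.range n, f (ω k) - n * ∫ ω : ℕ → ℝ, f (ω 0) ∂P) :=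
      hω
    rw [hmean0, mul_zero, sub_zero] at hω'
    exact (pos_iff_pos_of_mul_pos hω').1 (by positivity)
  -- for the finitely many other dimensions it is enough that the event is open and nonempty
  have hsmall : ∀ n : ℕ, 1 ≤ n →
      0 < (stdGaussian (EuclideanSpace ℝ (Fin n))).real {x | 0 < ∑ i, f (x i)} := by
    intro n hn
    refine ENNReal.toReal_pos ?_ (measure_ne_top _ _)
    refine IsOpen.measure_ne_zero _ (isOpen_lt continuous_const (by fun_prop)) ?_
    refine ⟨WithLp.toLp 2 fun _ => x₀, ?_⟩
    simpa using mul_pos (Nat.cast_pos.2 hn) hx₀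
  have hmin : ∃ c : ℝ, 0 < c ∧ ∀ n ∈ Finset.Icc 1 N, c ≤
      (stdGaussian (EuclideanSpace ℝ (Fin n))).real {x | 0 < ∑ i, f (x i)} := by
    rcases (Finset.Icc 1 N).eq_empty_or_nonempty with he | hne
    · exact ⟨1, one_pos, by simp [he]⟩
    · obtain ⟨m, hm, hm'⟩ := Finset.exists_min_image (Finset.Icc 1 N) (fun n =>
        (stdGaussian (EuclideanSpace ℝ (Fin n))).real {x | 0 < ∑ i, f (x i)}) hne
      exact ⟨_, hsmall m (Finset.mem_Icc.1 hm).1, hm'⟩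
  obtain ⟨c, hc, hc'⟩ := hmin
  have hqtop : q ≠ ⊤ := (hq.trans_le le_top).ne
  refine ⟨min c q.toReal, lt_min hc (ENNReal.toReal_pos hq0.ne' hqtop), fun n hn => ?_⟩
  rcases le_total n N with h | h
  · exact (min_le_left _ _).trans (hc' n (Finset.mem_Icc.2 ⟨hn, h⟩))
  · exact (min_le_right _ _).trans (ENNReal.toReal_mono (measure_ne_top _ _) (hlarge n hn h))

/-- Chebyshev's inequality for a centred sum. -/
theorem stdGaussian_sum_chebyshev {f : ℝ → ℝ} (hf : Continuous f)
    (hL : MemLp f 2 (gaussianReal 0 1)) (h0 : ∫ x, f x ∂(gaussianReal 0 1) = 0)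
    {n : ℕ} (hn : 1 ≤ n) {Q : ℝ} (hQ : 0 < Q) :
    (stdGaussian (EuclideanSpace ℝ (Fin n))).real {x | Q * √n ≤ |∑ i, f (x i)|} ≤
      Var[f; gaussianReal 0 1] / Q ^ 2 := by
  have hn' : (0 : ℝ) < n := by exact_mod_cast hn
  have hm : MeasurableSet {x : EuclideanSpace ℝ (Fin n) | Q * √n ≤ |∑ i, f (x i)|} :=
    measurableSet_le (by fun_prop) (by fun_prop)
  have hmem : ∀ i : Fin n, MemLp (fun x : Fin n → ℝ => f (x i))
      2 (Measure.pi fun _ : Fin n => gaussianReal 0 1) :=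
    fun i => hL.comp_measurePreserving (measurePreserving_eval _ i)
  have hmean :
      ∫ x : Fin n → ℝ, ∑ i, f (x i) ∂(Measure.pi fun _ : Fin n => gaussianReal 0 1) = 0 := by
    rw [integral_finsetSum _ fun i _ => (hmem i).integrable (by norm_num)]
    refine Finset.sum_eq_zero fun i _ => ?_
    rw [integral_comp_eval (μ := fun _ : Fin n => gaussianReal 0 1) hf.aestronglyMeasurable, h0]
  have hv : Var[fun x : Fin n → ℝ => ∑ i, f (x i); Measure.pi fun _ : Fin n => gaussianReal 0 1] =
      n * Var[f; gaussianReal 0 1] := by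
    have := variance_sum_pi (μ := fun _ : Fin n => gaussianReal 0 1) (X := fun _ => f) fun _ => hL
    simpa [Finset.sum_fn] using this
  have key := meas_ge_le_variance_div_sq (memLp_finsetSum _ fun i (_ : i ∈ Finset.univ) => hmem i)
    (show 0 < Q * √n by positivity)
  rw [hmean, hv] at key
  rw [measureReal_def, ← map_pi_eq_stdGaussian, Measure.map_apply (by fun_prop) hm]
  refine ENNReal.toReal_le_of_le_ofReal (div_nonneg (variance_nonneg _ _) (by positivity)) ?_
  simp only [sub_zero] at key
  refine key.trans_eq ?_
  congr 1
  rw [mul_pow, Real.sq_sqrt hn'.le]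
  field_simp

/-! ### Moments of `x ^ 2 - 1` and of `|x| - √(2 / π)` -/

lemma memLp_sq_sub_one : MemLp (fun x : ℝ => x ^ 2 - 1) 2 (gaussianReal 0 1) := by
  rw [memLp_two_iff_integrable_sq (by fun_prop)]
  have h4 : Integrable (fun x : ℝ => x ^ 4) (gaussianReal 0 1) := by
    have := (memLp_id_gaussianReal (μ := 0) (v := 1) 4).integrable_norm_pow (by norm_num)
    simpa [Even.pow_abs (by decide : Even 4)] using this
  have h2 : Integrable (fun x : ℝ => x ^ 2) (gaussianReal 0 1) := by
    have := (memLp_id_gaussianReal (μ := 0) (v := 1) 2).integrable_norm_pow (by norm_num)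
    simpa using this
  refine ((h4.sub (h2.const_mul 2)).add (integrable_const 1)).congr (ae_of_all _ fun x => ?_)
  simp only [Pi.add_apply, Pi.sub_apply]
  ring

lemma integral_sq_sub_one : ∫ x : ℝ, (x ^ 2 - 1) ∂(gaussianReal 0 1) = 0 := by
  have h2 : Integrable (fun x : ℝ => x ^ 2) (gaussianReal 0 1) := by
    have := (memLp_id_gaussianReal (μ := 0) (v := 1) 2).integrable_norm_pow (by norm_num)
    simpa using this
  have hv := variance_id_gaussianReal (μ := 0) (v := 1)
  rw [variance_eq_integral (by fun_prop)] at hv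
  simp only [id, integral_id_gaussianReal, sub_zero] at hv
  rw [integral_sub h2 (integrable_const 1), hv]
  simp

lemma memLp_abs_sub : MemLp (fun x : ℝ => |x| - √(2 / Real.pi)) 2 (gaussianReal 0 1) :=
  (memLp_id_gaussianReal 2).abs.sub (memLp_const _)

lemma integral_abs_sub : ∫ x : ℝ, (|x| - √(2 / Real.pi)) ∂(gaussianReal 0 1) = 0 := by
  have h1 : Integrable (fun x : ℝ => |x|) (gaussianReal 0 1) :=
    ((memLp_id_gaussianReal 1).integrable le_rfl).abs
  rw [integral_sub h1 (integrable_const _), integral_gaussianReal_eq_integral_smul one_ne_zero]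
  have e : ∀ x : ℝ, gaussianPDFReal 0 1 x • |x| =
      (√(2 * Real.pi))⁻¹ * (|x| * Real.exp (-(1 / 2) * |x| ^ 2)) := by
    intro x
    simp [gaussianPDFReal]
    ring_nf
  simp_rw [e]
  rw [integral_const_mul, integral_comp_abs (f := fun x => x * Real.exp (-(1 / 2) * x ^ 2))]
  have h := integral_mul_cexp_neg_mul_sq (b := (1 / 2 : ℂ)) (by norm_num)
  have h' : ∫ r : ℝ in Set.Ioi 0, r * Real.exp (-(1 / 2) * r ^ 2) = 1 := by
    have : ((∫ r : ℝ in Set.Ioi 0, r * Real.exp (-(1 / 2) * r ^ 2) : ℝ) : ℂ) = 1 := by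
      rw [← integral_complex_ofReal]
      refine Eq.trans ?_ (h.trans (by norm_num))
      congr 1
      ext r
      push_cast
      rfl
    exact_mod_cast this
  rw [h']
  have hπ := Real.pi_pos
  simp only [integral_const, probReal_univ, smul_eq_mul, one_mul, mul_one]
  rw [Real.sqrt_mul (by norm_num), Real.sqrt_div (by norm_num), sub_eq_zero]
  have : √(2 : ℝ) * √2 = 2 := Real.mul_self_sqrt (by norm_num)
  field_simp
  linarith

/-! ### Comparison of masses and anti-concentration of the maximum -/

section Comparison

variable {α : Type*} [MeasurableSpace α] {μ ν : Measure α}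

lemma mul_measureReal_le_of_density [IsFiniteMeasure ν] {A B : Set α} (hA : MeasurableSet A)
    {g : α → ℝ} {q : ℝ} (hq : 0 ≤ q) (hB : ν B = ∫⁻ x in A, ENNReal.ofReal (g x) ∂μ)
    (hg : ∀ x ∈ A, q ≤ g x) : q * μ.real A ≤ ν.real B := by
  have h : ENNReal.ofReal q * μ A ≤ ν B := by
    rw [hB, ← setLIntegral_const]
    exact setLIntegral_mono' hA fun x hx => ENNReal.ofReal_le_ofReal (hg x hx)
  have h2 := ENNReal.toReal_mono (measure_ne_top ν B) h
  rwa [ENNReal.toReal_mul, ENNReal.toReal_ofReal hq] at h2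

lemma measureReal_le_mul_of_density [IsFiniteMeasure μ] {A B : Set α} (hA : MeasurableSet A)
    {g : α → ℝ} {q : ℝ} (hq : 0 ≤ q) (hB : ν B = ∫⁻ x in A, ENNReal.ofReal (g x) ∂μ)
    (hg : ∀ x ∈ A, g x ≤ q) : ν.real B ≤ q * μ.real A := by
  have h : ν B ≤ ENNReal.ofReal q * μ A := by
    rw [hB, ← setLIntegral_const]
    exact setLIntegral_mono' hA fun x hx => ENNReal.ofReal_le_ofReal (hg x hx)
  have h2 := ENNReal.toReal_mono (ENNReal.mul_ne_top ENNReal.ofReal_ne_top (measure_ne_top μ A)) h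
  rwa [ENNReal.toReal_mul, ENNReal.toReal_ofReal hq] at h2

end Comparison

section Maximum

variable {E : Type*} [NormedAddCommGroup E] [InnerProductSpace ℝ E] {ι : Type*} [LinearOrder ι]

/-- The points at which the facet functional `⟪x, v i⟫ - θ i` is maximal for the index `j` (the
least such index), with maximum in `(0, δ]`. -/
def argmaxCell (v : ι → E) (θ : ι → ℝ) (δ : ℝ) (j : ι) : Set E :=
  {x | 0 < inner ℝ x (v j) - θ j ∧ inner ℝ x (v j) - θ j ≤ δ ∧
    ∀ i, inner ℝ x (v i) - θ i ≤ inner ℝ x (v j) - θ j ∧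
      (i < j → inner ℝ x (v i) - θ i < inner ℝ x (v j) - θ j)}

/-- Moving outwards along `v j` keeps `j` the least index of a maximal facet functional. -/
lemma argmaxCell_translate {v : ι → E} (hv : ∀ i, ‖v i‖ = 1) {θ : ι → ℝ} {δ a : ℝ} (ha : 0 ≤ a)
    {j : ι} {y : E} (hy : y - a • v j ∈ argmaxCell v θ δ j) :
    a < inner ℝ y (v j) - θ j ∧ inner ℝ y (v j) - θ j ≤ a + δ ∧
    ∀ i, inner ℝ y (v i) - θ i ≤ inner ℝ y (v j) - θ j ∧
      (i < j → inner ℝ y (v i) - θ i < inner ℝ y (v j) - θ j) := by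
  obtain ⟨h1, h2, h3⟩ := hy
  have hself : inner ℝ (v j) (v j) = 1 := by rw [real_inner_self_eq_norm_sq, hv j]; norm_num
  simp only [inner_sub_left, inner_smul_left, RCLike.conj_to_real, hself] at h1 h2 h3
  refine ⟨by linarith, by linarith, fun i => ?_⟩
  have hle : a * inner ℝ (v j) (v i) ≤ a * 1 := by
    refine mul_le_mul_of_nonneg_left ?_ ha
    simpa [hv i, hv j] using real_inner_le_norm (v j) (v i)
  obtain ⟨h4, h5⟩ := h3 i
  exact ⟨by linarith, fun hij => by linarith [h5 hij]⟩

variable [FiniteDimensional ℝ E] [MeasurableSpace E] [BorelSpace E] [Fintype ι]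

lemma measurableSet_argmaxCell (v : ι → E) (θ : ι → ℝ) (δ : ℝ) (j : ι) :
    MeasurableSet (argmaxCell v θ δ j) := by
  have hm : ∀ i, Measurable fun x : E => inner ℝ x (v i) - θ i := fun i => by fun_prop
  have h : argmaxCell v θ δ j = {x | 0 < inner ℝ x (v j) - θ j} ∩
      ({x | inner ℝ x (v j) - θ j ≤ δ} ∩
        ⋂ i, {x : E | inner ℝ x (v i) - θ i ≤ inner ℝ x (v j) - θ j} ∩
          {x : E | i < j → inner ℝ x (v i) - θ i < inner ℝ x (v j) - θ j}) := by
    ext x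
    simp [argmaxCell]
  rw [h]
  refine (measurableSet_lt measurable_const (hm j)).inter
    ((measurableSet_le (hm j) measurable_const).inter ?_)
  refine MeasurableSet.iInter fun i => (measurableSet_le (hm i) (hm j)).inter ?_
  by_cases h : i < j
  · simpa [h] using measurableSet_lt (hm i) (hm j)
  · simp [h]

/-- **Anti-concentration of the maximum.** The maximum of the functionals `⟪x, v i⟫ - θ i` lies in
`(0, δ]` with probability at most `O(δ (T + 1))` if all the thresholds are at most `T`. The cell in
which the maximum is attained at `j` can be translated by `k δ v j` for all `k ≤ 1 / (δ (T + 1))`;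
all these translates are disjoint and none is lighter than the cell by more than a constant
factor. -/
theorem stdGaussian_max_anticoncentration {v : ι → E} (hv : ∀ i, ‖v i‖ = 1) {θ : ι → ℝ} {T δ : ℝ}
    (hT : 0 ≤ T) (hθ : ∀ i, θ i ≤ T) (hδ : 0 < δ) {K : ℕ} (hK : K * (δ * (T + 1)) ≤ 1) :
    K * (stdGaussian E).real {x | (∃ j, θ j < inner ℝ x (v j)) ∧
      ∀ j, inner ℝ x (v j) ≤ θ j + δ} ≤ Real.exp 2 := by
  classical
  set γ := stdGaussian E
  -- the event is covered by the cells
  have hcover : {x : E | (∃ j, θ j < inner ℝ x (v j)) ∧ ∀ j, inner ℝ x (v j) ≤ θ j + δ} ⊆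
      ⋃ j, argmaxCell v θ δ j := by
    rintro x ⟨⟨j₀, hj₀⟩, hx⟩
    let S := Finset.univ.filter fun j => ∀ i, inner ℝ x (v i) - θ i ≤ inner ℝ x (v j) - θ j
    have hS : S.Nonempty := by
      obtain ⟨j, -, hj⟩ := Finset.exists_max_image Finset.univ
        (fun i => inner ℝ x (v i) - θ i) ⟨j₀, Finset.mem_univ _⟩
      exact ⟨j, by simpa [S] using hj⟩
    have hmin := S.min'_mem hS
    have hmax : ∀ i, inner ℝ x (v i) - θ i ≤ inner ℝ x (v (S.min' hS)) - θ (S.min' hS) :=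
      (Finset.mem_filter.1 hmin).2
    refine Set.mem_iUnion.2 ⟨S.min' hS, by linarith [hmax j₀], by linarith [hx (S.min' hS)],
      fun i => ⟨hmax i, fun hi => lt_of_le_of_ne (hmax i) fun heq => ?_⟩⟩
    have : i ∈ S := Finset.mem_filter.2 ⟨Finset.mem_univ _, fun k => heq ▸ hmax k⟩
    exact absurd (S.min'_le i this) (not_le.2 hi)
  have h1 : γ.real {x : E | (∃ j, θ j < inner ℝ x (v j)) ∧ ∀ j, inner ℝ x (v j) ≤ θ j + δ} ≤
      ∑ j, γ.real (argmaxCell v θ δ j) :=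
    (measureReal_mono hcover (measure_ne_top _ _)).trans (measureReal_iUnion_fintype_le _)
  -- each translate has comparable mass
  let F : ι × ℕ → Set E := fun p => {y | y - ((p.2 : ℝ) * δ) • v p.1 ∈ argmaxCell v θ δ p.1}
  have hFm : ∀ p, MeasurableSet (F p) := fun p =>
    (measurable_id.sub_const _) (measurableSet_argmaxCell v θ δ p.1)
  have h2 : ∀ j, ∀ k ∈ Finset.range K,
      Real.exp (-2) * γ.real (argmaxCell v θ δ j) ≤ γ.real (F (j, k)) := by
    intro j k hk
    refine mul_measureReal_le_of_density (measurableSet_argmaxCell v θ δ j) (Real.exp_pos _).le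
      (stdGaussian_translate (measurableSet_argmaxCell v θ δ j) _) fun x hx => ?_
    refine Real.exp_le_exp.2 ?_
    have hkK : (k : ℝ) + 1 ≤ K := by exact_mod_cast Finset.mem_range.1 hk
    have hk0 : (0 : ℝ) ≤ k := Nat.cast_nonneg k
    have hδT : 0 < δ * (T + 1) := by positivity
    have ha0 : 0 ≤ k * δ := by positivity
    have ha1 : k * δ * (T + 1) ≤ 1 := by nlinarith
    have hδ1 : δ ≤ 1 := by nlinarith
    have ha2 : k * δ ≤ 1 := by nlinarith
    have hin : inner ℝ x (v j) ≤ T + 1 := by linarith [hx.2.1, hθ j]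
    rw [inner_smul_right, norm_smul, hv j, mul_one, Real.norm_eq_abs, sq_abs]
    nlinarith
  -- the translates are disjoint
  have h3 : ∑ p ∈ Finset.univ ×ˢ Finset.range K, γ.real (F p) ≤ 1 := by
    rw [← measureReal_biUnion_finset ?_ fun p _ => hFm p]
    · exact measureReal_le_one
    rintro ⟨j, k⟩ - ⟨j', k'⟩ - hne
    refine Set.disjoint_left.2 fun y hy hy' => hne ?_
    obtain ⟨a1, a2, a3⟩ := argmaxCell_translate hv (by positivity) hy
    obtain ⟨b1, b2, b3⟩ := argmaxCell_translate hv (by positivity) hy'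
    simp only at a1 a2 a3 b1 b2 b3
    have hj : j = j' := by
      rcases lt_trichotomy j j' with h | h | h
      · linarith [(b3 j).2 h, (a3 j').1]
      · exact h
      · linarith [(a3 j').2 h, (b3 j).1]
    subst hj
    have hk : (k : ℝ) * δ < (k' + 1) * δ := by linarith
    have hk' : (k' : ℝ) * δ < (k + 1) * δ := by linarith
    have c1 := lt_of_mul_lt_mul_right hk hδ.le
    have c2 := lt_of_mul_lt_mul_right hk' hδ.le
    norm_cast at c1 c2
    simp only [Prod.mk.injEq, true_and]
    omega
  have h4 : ∑ j, (K : ℝ) * (Real.exp (-2) * γ.real (argmaxCell v θ δ j)) ≤ 1 := by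
    refine le_trans ?_ h3
    rw [Finset.sum_product]
    refine Finset.sum_le_sum fun j _ => ?_
    have := Finset.card_nsmul_le_sum (Finset.range K) (fun k => γ.real (F (j, k))) _ (h2 j)
    simpa using this
  rw [← Finset.mul_sum, ← Finset.mul_sum] at h4
  have h5 : Real.exp 2 * Real.exp (-2) = 1 := by rw [← Real.exp_add]; simp
  calc (K : ℝ) * γ.real _ ≤ K * ∑ j, γ.real (argmaxCell v θ δ j) := by gcongr
    _ = Real.exp 2 * (K * (Real.exp (-2) * ∑ j, γ.real (argmaxCell v θ δ j))) := by
        linear_combination -(K * ∑ j, γ.real (argmaxCell v θ δ j)) * h5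
    _ ≤ Real.exp 2 * 1 := by gcongr
    _ = Real.exp 2 := mul_one _

end Maximum

lemma sum_sq_sub_one {n : ℕ} (x : EuclideanSpace ℝ (Fin n)) :
    ∑ i, (x i ^ 2 - 1) = ‖x‖ ^ 2 - n := by
  rw [EuclideanSpace.real_norm_sq_eq]
  simp

/-- Dilation by `exp (R / √n)` maps sets of small Gaussian measure to sets of small Gaussian
measure, uniformly in the dimension: the density is bounded except where `‖x‖²` is far below `n`,
and there Chebyshev's inequality applies. -/
theorem exists_stdGaussian_dilate_le {R ρ : ℝ} (hR : 0 ≤ R) (hρ : 0 < ρ) :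
    ∃ ε : ℝ, 0 < ε ∧ ∀ n : ℕ, 1 ≤ n → ∀ A : Set (EuclideanSpace ℝ (Fin n)), MeasurableSet A →
      (stdGaussian (EuclideanSpace ℝ (Fin n))).real A ≤ ε →
        (stdGaussian (EuclideanSpace ℝ (Fin n))).real {y | Real.exp (-(R / √n)) • y ∈ A} ≤ ρ := by
  set V := Var[fun x : ℝ => x ^ 2 - 1; gaussianReal 0 1] with hV
  have hV0 : 0 ≤ V := variance_nonneg _ _
  obtain ⟨Q, hQ, hQV⟩ : ∃ Q : ℝ, 0 < Q ∧ V / Q ^ 2 ≤ ρ / 2 := by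
    refine ⟨√(2 * V / ρ + 1), by positivity, ?_⟩
    rw [Real.sq_sqrt (by positivity), div_le_iff₀ (by positivity)]
    have : ρ / 2 * (2 * V / ρ + 1) = V + ρ / 2 := by field_simp
    linarith
  refine ⟨ρ / 2 * Real.exp (-(R * (Q + 2 * R))), by positivity, fun n hn A hA hAε => ?_⟩
  have hn0 : (0 : ℝ) < n := by exact_mod_cast hn
  set s := √(n : ℝ) with hs
  have hs0 : 0 < s := Real.sqrt_pos.2 hn0
  have hss : s * s = n := Real.mul_self_sqrt hn0.le
  set w := R / s with hw
  have hw0 : 0 ≤ w := by positivity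
  have hws : w * s = R := by rw [hw]; field_simp
  set A' := A ∩ {x | n - (Q + 2 * R) * s ≤ ‖x‖ ^ 2} with hA'
  have hA'm : MeasurableSet A' := hA.inter (measurableSet_le (by fun_prop) (by fun_prop))
  have hsub : {y : EuclideanSpace ℝ (Fin n) | Real.exp (-w) • y ∈ A} ⊆
      {y | Q * s ≤ |∑ i, (y i ^ 2 - 1)|} ∪ {y | Real.exp (-w) • y ∈ A'} := by
    intro y hy
    by_cases h : Q * s ≤ |∑ i, (y i ^ 2 - 1)|
    · exact Or.inl h
    · refine Or.inr ⟨hy, ?_⟩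
      rw [sum_sq_sub_one, not_le, abs_lt] at h
      change n - (Q + 2 * R) * s ≤ ‖Real.exp (-w) • y‖ ^ 2
      rw [norm_smul, mul_pow, Real.norm_eq_abs, Real.abs_exp, ← Real.exp_nat_mul]
      have he : 1 - 2 * w ≤ Real.exp ((2 : ℕ) * -w) := by
        have := Real.add_one_le_exp ((2 : ℕ) * -w)
        push_cast at this ⊢
        linarith
      have he0 := Real.exp_pos ((2 : ℕ) * -w)
      rcases le_total (n - Q * s : ℝ) 0 with h0 | h0
      · have : 0 ≤ Real.exp ((2 : ℕ) * -w) * ‖y‖ ^ 2 := by positivity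
        nlinarith [mul_nonneg hR hs0.le]
      · have h6 : Real.exp ((2 : ℕ) * -w) * (n - Q * s) ≤ Real.exp ((2 : ℕ) * -w) * ‖y‖ ^ 2 :=
          mul_le_mul_of_nonneg_left (by linarith) he0.le
        have h7 : (1 - 2 * w) * (n - Q * s) ≤ Real.exp ((2 : ℕ) * -w) * (n - Q * s) :=
          mul_le_mul_of_nonneg_right he h0
        have h8 : w * n = R * s := by rw [← hss, ← mul_assoc, hws]
        nlinarith [mul_nonneg (mul_nonneg hw0 hQ.le) hs0.le]
  have h1 := stdGaussian_sum_chebyshev (f := fun x => x ^ 2 - 1) (by fun_prop)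
    memLp_sq_sub_one integral_sq_sub_one hn hQ
  have h2 : (stdGaussian (EuclideanSpace ℝ (Fin n))).real {y | Real.exp (-w) • y ∈ A'} ≤
      Real.exp (R * (Q + 2 * R)) * (stdGaussian (EuclideanSpace ℝ (Fin n))).real A' := by
    refine measureReal_le_mul_of_density hA'm (Real.exp_pos _).le (stdGaussian_dilate hA'm w)
      fun x hx => Real.exp_le_exp.2 ?_
    have hx2 : n - (Q + 2 * R) * s ≤ ‖x‖ ^ 2 := hx.2
    rw [finrank_euclideanSpace_fin]
    have he : 2 * w ≤ Real.exp (2 * w) - 1 := by linarith [Real.add_one_le_exp (2 * w)]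
    have h3 : w * (n - ‖x‖ ^ 2) ≤ w * ((Q + 2 * R) * s) :=
      mul_le_mul_of_nonneg_left (by linarith) hw0
    have h4 : w * ((Q + 2 * R) * s) = R * (Q + 2 * R) := by rw [← hws]; ring
    nlinarith [sq_nonneg ‖x‖, mul_le_mul_of_nonneg_right he (sq_nonneg ‖x‖)]
  have h3 : (stdGaussian (EuclideanSpace ℝ (Fin n))).real A' ≤
      (stdGaussian (EuclideanSpace ℝ (Fin n))).real A :=
    measureReal_mono Set.inter_subset_left (measure_ne_top _ _)
  have h4 : Real.exp (R * (Q + 2 * R)) * Real.exp (-(R * (Q + 2 * R))) = 1 := by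
    rw [← Real.exp_add]; simp
  calc (stdGaussian (EuclideanSpace ℝ (Fin n))).real {y | Real.exp (-w) • y ∈ A}
      ≤ _ := measureReal_mono hsub (measure_ne_top _ _)
    _ ≤ _ := measureReal_union_le _ _
    _ ≤ ρ / 2 + Real.exp (R * (Q + 2 * R)) * (ρ / 2 * Real.exp (-(R * (Q + 2 * R)))) := by
        refine add_le_add (h1.trans hQV) (h2.trans ?_)
        exact mul_le_mul_of_nonneg_left (h3.trans hAε) (Real.exp_pos _).le
    _ = ρ := by linear_combination ρ / 2 * h4

/-! ### Lower bounds on the number of facets -/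

section Polytope

variable {E : Type*} [NormedAddCommGroup E] [InnerProductSpace ℝ E]
  [FiniteDimensional ℝ E] [MeasurableSpace E] [BorelSpace E]

lemma stdGaussian_tail {v : E} (hv : ‖v‖ = 1) {T : ℝ} (hT : 0 ≤ T) :
    (stdGaussian E).real {y | T < inner ℝ y v} ≤ Real.exp (-T ^ 2 / 2) := by
  have hA : MeasurableSet {x : E | 0 < inner ℝ x v} := measurableSet_lt (by fun_prop) (by fun_prop)
  have hset : {y : E | T < inner ℝ y v} = {y | y - T • v ∈ {x : E | 0 < inner ℝ x v}} := by
    ext y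
    simp [inner_sub_left, inner_smul_left, hv]
  rw [hset]
  refine (measureReal_le_mul_of_density hA (Real.exp_pos (-T ^ 2 / 2)).le
    (stdGaussian_translate hA (T • v)) fun x hx => Real.exp_le_exp.2 ?_).trans ?_
  · have hx' : 0 < inner ℝ x v := hx
    rw [inner_smul_right, norm_smul, hv, mul_one, Real.norm_eq_abs, sq_abs]
    nlinarith [mul_nonneg hT hx'.le]
  · exact mul_le_of_le_one_right (Real.exp_pos _).le measureReal_le_one

/-- A dilation of an intersection of halfspaces gains little mass: the facets at distance more
than `T` from the origin are controlled by a union bound, the others by anti-concentration of the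
maximum, as each of them moves by at most `(exp w - 1) T`. -/
theorem stdGaussian_dilate_diff_le {M : ℕ} {v : Fin M → E} (hv : ∀ i, ‖v i‖ = 1) (θ : Fin M → ℝ)
    {T w : ℝ} (hT : 0 < T) (hw : 0 < w) {m : ℕ}
    (hm : m * ((Real.exp w - 1) * T * (T + 1)) ≤ 1) :
    m * ((stdGaussian E).real {y | (∃ j, θ j < inner ℝ y (v j)) ∧
        ∀ j, inner ℝ (Real.exp (-w) • y) (v j) ≤ θ j} - M * Real.exp (-T ^ 2 / 2)) ≤
      Real.exp 2 := by
  set γ := stdGaussian E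
  have hew : 0 < Real.exp w - 1 := by linarith [Real.add_one_lt_exp hw.ne']
  have hδ : 0 < (Real.exp w - 1) * T := mul_pos hew hT
  have hmain := stdGaussian_max_anticoncentration (E := E) (ι := {j : Fin M // θ j ≤ T})
    (v := fun j => v j) (θ := fun j => θ j) (T := T) (fun i => hv i) hT.le (fun i => i.2)
    hδ (K := m) hm
  refine le_trans (mul_le_mul_of_nonneg_left ?_ (Nat.cast_nonneg m)) hmain
  have hfar : γ.real (⋃ j, {y | T < inner ℝ y (v j)}) ≤ M * Real.exp (-T ^ 2 / 2) := by
    refine (measureReal_iUnion_fintype_le _).trans ?_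
    refine (Finset.sum_le_sum fun j _ => stdGaussian_tail (hv j) hT.le).trans ?_
    simp
  have hsub : {y : E | (∃ j, θ j < inner ℝ y (v j)) ∧
      ∀ j, inner ℝ (Real.exp (-w) • y) (v j) ≤ θ j} ⊆
      {x : E | (∃ j : {j : Fin M // θ j ≤ T}, θ j < inner ℝ x (v j)) ∧
        ∀ j : {j : Fin M // θ j ≤ T}, inner ℝ x (v j) ≤ θ j + (Real.exp w - 1) * T} ∪
      ⋃ j, {y | T < inner ℝ y (v j)} := by
    rintro y ⟨⟨j, hj⟩, hy⟩
    by_cases h : ∃ j, T < inner ℝ y (v j)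
    · exact Or.inr (Set.mem_iUnion.2 h)
    · push Not at h
      refine Or.inl ⟨⟨⟨j, hj.le.trans (h j)⟩, hj⟩, fun i => ?_⟩
      have h1 := hy i
      rw [inner_smul_left, RCLike.conj_to_real] at h1
      have h2 := mul_le_mul_of_nonneg_left h1 (Real.exp_pos w).le
      rw [← mul_assoc, ← Real.exp_add, add_neg_cancel, Real.exp_zero, one_mul] at h2
      have h3 := mul_le_mul_of_nonneg_left i.2 hew.le
      linarith
  have := (measureReal_mono hsub (measure_ne_top γ _)).trans (measureReal_union_le _ _)
  linarith

end Polytope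

lemma IsHalfspace.measurableSet {n : ℕ} {H : Set (EuclideanSpace ℝ (Fin n))} (h : IsHalfspace H) :
    MeasurableSet H := by
  obtain ⟨v, θ, -, rfl⟩ := h
  exact measurableSet_le (by fun_prop) (by fun_prop)

lemma measurableSet_of_mem_facet {n M : ℕ} {L : Set (EuclideanSpace ℝ (Fin n))}
    (h : L ∈ Facet n M) : MeasurableSet L := by
  obtain ⟨H, hH, rfl⟩ := h
  exact MeasurableSet.iInter fun i => (hH i).measurableSet

/-- A symmetric set whose mass is bounded away from `0` and `1` is not close to a halfspace or to
the whole space: of a halfspace and its reflection, either the union is everything or the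
intersection is empty. -/
lemma two_le_of_mem_facet {n M : ℕ} {K L : Set (EuclideanSpace ℝ (Fin n))} (hK : MeasurableSet K)
    (hsymm : ∀ x, -x ∈ K ↔ x ∈ K) (hL : L ∈ Facet n M) {ε : ℝ} (hd : distG K L ≤ ε)
    (h1 : 2 * ε < (stdGaussian (EuclideanSpace ℝ (Fin n))).real K)
    (h2 : 2 * ε < (stdGaussian (EuclideanSpace ℝ (Fin n))).real Kᶜ) : 2 ≤ M := by
  by_contra hM
  set γ := stdGaussian (EuclideanSpace ℝ (Fin n))
  have hS : MeasurableSet (symmDiff K L) := hK.symmDiff (measurableSet_of_mem_facet hL)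
  have hγ : γ.real (symmDiff K L ∪ {x | -x ∈ symmDiff K L}) ≤ 2 * ε := by
    refine (measureReal_union_le _ _).trans ?_
    have : γ.real {x | -x ∈ symmDiff K L} = γ.real (symmDiff K L) := by
      rw [measureReal_def, measureReal_def, stdGaussian_neg hS]
    rw [this]
    have : γ.real (symmDiff K L) ≤ ε := hd
    linarith
  have hLcases : (∀ x, x ∈ L ∨ -x ∈ L) ∨ ∀ x, x ∉ L ∨ -x ∉ L := by
    obtain ⟨H, hH, rfl⟩ := hL
    obtain rfl | rfl : M = 0 ∨ M = 1 := by omega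
    · left; simp
    · obtain ⟨v, θ, -, hHv⟩ := hH 0
      have hmem : ∀ x, x ∈ ⋂ i, H i ↔ inner ℝ x v ≤ θ := by
        intro x
        simp [Fin.forall_fin_one, hHv]
      simp only [hmem, inner_neg_left, not_le]
      rcases le_or_gt 0 θ with h | h
      · left
        intro x
        rcases le_total (inner ℝ x v) 0 with h' | h'
        · left; linarith
        · right; linarith
      · right
        intro x
        rcases le_total (inner ℝ x v) 0 with h' | h'
        · right; linarith
        · left; linarith
  rcases hLcases with h | h
  · have hsub : Kᶜ ⊆ symmDiff K L ∪ {x | -x ∈ symmDiff K L} := by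
      intro x hx
      have hx' : -x ∉ K := fun h' => hx ((hsymm x).1 h')
      rcases h x with h' | h'
      · exact Or.inl (Or.inr ⟨h', hx⟩)
      · exact Or.inr (Or.inr ⟨h', hx'⟩)
    exact absurd ((measureReal_mono hsub (measure_ne_top γ _)).trans hγ) (not_le.2 h2)
  · have hsub : K ⊆ symmDiff K L ∪ {x | -x ∈ symmDiff K L} := by
      intro x hx
      have hx' : -x ∈ K := (hsymm x).2 hx
      rcases h x with h' | h'
      · exact Or.inl (Or.inl ⟨hx, h'⟩)
      · exact Or.inr (Or.inl ⟨hx', h'⟩)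
    exact absurd ((measureReal_mono hsub (measure_ne_top γ _)).trans hγ) (not_le.2 h1)

/-- If `K` and `L` are close, and so are their dilates, then `L` gains about as much mass under
the dilation as `K` does. -/
lemma compl_le_dilate_diff {n : ℕ} (K L : Set (EuclideanSpace ℝ (Fin n))) (t : ℝ) :
    (stdGaussian (EuclideanSpace ℝ (Fin n))).real Kᶜ ≤
      (stdGaussian (EuclideanSpace ℝ (Fin n))).real {y | y ∉ L ∧ t • y ∈ L} +
      (stdGaussian (EuclideanSpace ℝ (Fin n))).real {y | t • y ∉ K} +
      (stdGaussian (EuclideanSpace ℝ (Fin n))).real {y | t • y ∈ symmDiff K L} +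
      (stdGaussian (EuclideanSpace ℝ (Fin n))).real (symmDiff K L) := by
  set γ := stdGaussian (EuclideanSpace ℝ (Fin n))
  have hsub : Kᶜ ⊆ (({y | y ∉ L ∧ t • y ∈ L} ∪ {y | t • y ∉ K}) ∪ {y | t • y ∈ symmDiff K L}) ∪
      symmDiff K L := by
    intro y hy
    by_cases hyL : y ∈ L
    · exact Or.inr (Or.inr ⟨hyL, hy⟩)
    by_cases htL : t • y ∈ L
    · exact Or.inl (Or.inl (Or.inl ⟨hyL, htL⟩))
    by_cases htK : t • y ∈ K
    · exact Or.inl (Or.inr (Or.inl ⟨htK, htL⟩))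
    · exact Or.inl (Or.inl (Or.inr htK))
  refine (measureReal_mono hsub (measure_ne_top γ _)).trans ?_
  refine (measureReal_union_le _ _).trans (add_le_add_left ?_ _)
  refine (measureReal_union_le _ _).trans (add_le_add_left ?_ _)
  exact measureReal_union_le _ _

/-- The lower bound on the number of facets, for a body `K = {x | ∑ f(x_i) ≤ 0}` given by a centred
even function `f`, such that `∑ f(x_i)` is at least of order `R √n` outside the dilate of `K` by
`exp (R / √n)`. -/
theorem facet_lower_bound {f : ℝ → ℝ} (hf : Continuous f)
    (hL : MemLp f 2 (gaussianReal 0 1)) (h0 : ∫ x, f x ∂(gaussianReal 0 1) = 0)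
    (hpos : ∃ x, 0 < f x) (hneg : ∃ x, f x < 0) (heven : ∀ x, f (-x) = f x)
    (K : ∀ n : ℕ, Set (EuclideanSpace ℝ (Fin n))) (hK : ∀ n x, x ∈ K n ↔ ∑ i, f (x i) ≤ 0)
    {a : ℝ} (ha : 0 < a) (hdil : ∀ n : ℕ, 1 ≤ n → ∀ R : ℝ, 0 ≤ R →
      ∀ x : EuclideanSpace ℝ (Fin n), Real.exp (-(R / √n)) • x ∉ K n → a * R * √n ≤ ∑ i, f (x i)) :
    ∃ ε : ℝ, 0 < ε ∧ ∃ c : ℝ, 0 < c ∧ ∀ n : ℕ, 1 ≤ n → ∀ M : ℕ, ∀ L ∈ Facet n M,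
      distG (K n) L ≤ ε → (2 : ℝ) ^ (c * Real.sqrt n) ≤ M := by
  obtain ⟨c₁, hc₁, hc₁'⟩ := exists_le_stdGaussian_sum_pos hf hL h0 hpos
  obtain ⟨c₂, hc₂, hc₂'⟩ := exists_le_stdGaussian_sum_pos hf.neg hL.neg
    (by simp [integral_neg, h0]) (by simpa using hneg)
  set c₀ := min c₁ c₂ with hc₀
  have hc₀pos : 0 < c₀ := lt_min hc₁ hc₂
  have hKm : ∀ n, MeasurableSet (K n) := by
    intro n
    have : K n = {x | ∑ i, f (x i) ≤ 0} := by ext x; exact hK n x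
    rw [this]
    exact measurableSet_le (by fun_prop) (by fun_prop)
  have hKc : ∀ n : ℕ, 1 ≤ n → c₀ ≤ (stdGaussian (EuclideanSpace ℝ (Fin n))).real (K n)ᶜ := by
    intro n hn
    refine (min_le_left _ _).trans ((hc₁' n hn).trans (measureReal_mono ?_ (measure_ne_top _ _)))
    intro x hx
    rw [Set.mem_compl_iff, hK, not_le]
    exact hx
  have hKl : ∀ n : ℕ, 1 ≤ n → c₀ ≤ (stdGaussian (EuclideanSpace ℝ (Fin n))).real (K n) := by
    intro n hn
    refine (min_le_right _ _).trans ((hc₂' n hn).trans (measureReal_mono ?_ (measure_ne_top _ _)))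
    intro x hx
    rw [hK]
    have hx' : 0 < ∑ i, (-f) (x i) := hx
    simp only [Pi.neg_apply, Finset.sum_neg_distrib] at hx'
    linarith
  have hc₀1 : c₀ ≤ 1 := (hKl 1 le_rfl).trans measureReal_le_one
  set V := Var[f; gaussianReal 0 1] with hV
  have hV0 : 0 ≤ V := variance_nonneg _ _
  obtain ⟨R, hR, hRV⟩ : ∃ R : ℝ, 0 < R ∧ V / (a * R) ^ 2 ≤ c₀ / 4 := by
    refine ⟨√(4 * V / c₀ + 1) / a, by positivity, ?_⟩
    rw [mul_div_cancel₀ _ ha.ne', Real.sq_sqrt (by positivity), div_le_iff₀ (by positivity)]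
    have : c₀ / 4 * (4 * V / c₀ + 1) = V + c₀ / 4 := by field_simp
    linarith
  obtain ⟨ε₀, hε₀, hdilate⟩ := exists_stdGaussian_dilate_le hR.le
    (show 0 < c₀ / 8 by positivity)
  -- the number of disjoint translates that would contradict the gap
  obtain ⟨m, hm⟩ := exists_nat_gt (4 * Real.exp 2 / c₀)
  have hm0 : (0 : ℝ) < m := lt_trans (by positivity) hm
  set B := 2 * m * Real.exp R * R with hB
  set D := 2 + 2 * Real.log (4 / c₀) / Real.log 2 with hD
  have hlog2 : 0 < Real.log 2 := Real.log_pos (by norm_num)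
  have hlogc : 0 ≤ Real.log (4 / c₀) :=
    Real.log_nonneg ((one_le_div hc₀pos).2 (by linarith))
  have hBpos : 0 < B := by positivity
  have hDpos : 0 < D := by positivity
  refine ⟨min ε₀ (c₀ / 8), lt_min hε₀ (by positivity), 1 / (B * D * Real.log 2), by positivity,
    fun n hn M L hLM hd => ?_⟩
  have hsymm : ∀ x, -x ∈ K n ↔ x ∈ K n := by
    intro x
    rw [hK, hK]
    simp [heven]
  have hd1 : distG (K n) L ≤ ε₀ := hd.trans (min_le_left _ _)
  have hd2 : distG (K n) L ≤ c₀ / 8 := hd.trans (min_le_right _ _)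
  have hM2 : 2 ≤ M := two_le_of_mem_facet (hKm n) hsymm hLM hd2
    (lt_of_lt_of_le (by linarith) (hKl n hn)) (lt_of_lt_of_le (by linarith) (hKc n hn))
  have hM2' : (2 : ℝ) ≤ M := by exact_mod_cast hM2
  have hn0 : (0 : ℝ) < n := by exact_mod_cast hn
  have hn1 : (1 : ℝ) ≤ √n := by rw [Real.one_le_sqrt]; exact_mod_cast hn
  have hs0 : 0 < √(n : ℝ) := Real.sqrt_pos.2 hn0
  set w := R / √n with hw
  have hw0 : 0 < w := by positivity
  have hwR : w ≤ R := div_le_self hR.le hn1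
  -- the gap in mass between `L` and its dilate
  have hgap : c₀ / 2 ≤ (stdGaussian (EuclideanSpace ℝ (Fin n))).real
      {y | y ∉ L ∧ Real.exp (-w) • y ∈ L} := by
    have h1 := compl_le_dilate_diff (K n) L (Real.exp (-w))
    have h2 : (stdGaussian (EuclideanSpace ℝ (Fin n))).real {y | Real.exp (-w) • y ∉ K n} ≤
        c₀ / 4 := by
      refine le_trans (measureReal_mono ?_ (measure_ne_top _ _))
        ((stdGaussian_sum_chebyshev hf hL h0 hn (show 0 < a * R by positivity)).trans hRV)
      intro y hy
      exact (hdil n hn R hR.le y hy).trans (le_abs_self _)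
    have h3 := hdilate n hn (symmDiff (K n) L)
      ((hKm n).symmDiff (measurableSet_of_mem_facet hLM)) hd1
    have h4 := hKc n hn
    have h5 : (stdGaussian (EuclideanSpace ℝ (Fin n))).real (symmDiff (K n) L) ≤ c₀ / 8 := hd2
    linarith
  obtain ⟨H, hH, rfl⟩ := hLM
  choose v θ hv hHv using hH
  set T := √(2 * Real.log (4 * M / c₀)) with hTdef
  have hlogM : Real.log (4 * M / c₀) = Real.log M + Real.log (4 / c₀) := by
    rw [← Real.log_mul (by positivity) (by positivity)]
    congr 1
    ring
  have hlogM2 : Real.log 2 ≤ Real.log M := Real.log_le_log (by norm_num) hM2'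
  have hT2 : T ^ 2 = 2 * Real.log (4 * M / c₀) := Real.sq_sqrt (by rw [hlogM]; linarith)
  have hT1 : 1 ≤ T := by
    rw [hTdef, Real.one_le_sqrt, hlogM]
    linarith [Real.log_two_gt_d9]
  have hexpT : M * Real.exp (-T ^ 2 / 2) = c₀ / 4 := by
    have : -T ^ 2 / 2 = -Real.log (4 * M / c₀) := by rw [neg_div, hT2]; ring
    rw [this, Real.exp_neg, Real.exp_log (by positivity)]
    field_simp
  have hset : {y | y ∉ ⋂ i, H i ∧ Real.exp (-w) • y ∈ ⋂ i, H i} =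
      {y | (∃ j, θ j < inner ℝ y (v j)) ∧
        ∀ j, inner ℝ (Real.exp (-w) • y) (v j) ≤ θ j} := by
    ext y
    simp [hHv]
  rw [hset] at hgap
  have hmany : 1 < m * ((Real.exp w - 1) * T * (T + 1)) := by
    by_contra hcon
    have h1 := stdGaussian_dilate_diff_le hv θ (lt_of_lt_of_le one_pos hT1) hw0 (not_lt.1 hcon)
    rw [hexpT] at h1
    have h2 : m * (c₀ / 4) ≤ Real.exp 2 :=
      le_trans (mul_le_mul_of_nonneg_left (by linarith) hm0.le) h1
    rw [div_lt_iff₀ hc₀pos] at hm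
    linarith
  have hexpw : Real.exp w - 1 ≤ w * Real.exp R := by
    have h1 : 1 - w ≤ Real.exp (-w) := by linarith [Real.add_one_le_exp (-w)]
    have h2 : Real.exp w * Real.exp (-w) = 1 := by rw [← Real.exp_add]; simp
    have h3 : Real.exp w ≤ Real.exp R := Real.exp_le_exp.2 hwR
    nlinarith [Real.exp_pos w]
  have hfin : √n ≤ B * T ^ 2 := by
    have h1 : (Real.exp w - 1) * T * (T + 1) ≤ w * Real.exp R * T * (2 * T) := by
      have hT0 : 0 ≤ T := zero_le_one.trans hT1
      exact mul_le_mul (mul_le_mul_of_nonneg_right hexpw hT0) (by linarith) (by linarith)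
        (by positivity)
    have h2 : 1 ≤ m * (w * Real.exp R * T * (2 * T)) :=
      hmany.le.trans (mul_le_mul_of_nonneg_left h1 hm0.le)
    have h3 : m * (w * Real.exp R * T * (2 * T)) = B * T ^ 2 / √n := by
      rw [hw, hB]
      field_simp
    rwa [h3, one_le_div hs0] at h2
  have hTD : T ^ 2 ≤ D * Real.log M := by
    rw [hT2, hlogM, hD]
    have : Real.log (4 / c₀) ≤ Real.log (4 / c₀) / Real.log 2 * Real.log M := by
      rw [div_mul_eq_mul_div, le_div_iff₀ hlog2]
      exact mul_le_mul_of_nonneg_left hlogM2 hlogc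
    rw [mul_div_assoc]
    linarith
  rw [Real.rpow_def_of_pos (by norm_num), ← Real.le_log_iff_exp_le (by linarith)]
  calc Real.log 2 * (1 / (B * D * Real.log 2) * √n) = √n / (B * D) := by field_simp
    _ ≤ B * (D * Real.log M) / (B * D) := by
        gcongr
        exact hfin.trans (mul_le_mul_of_nonneg_left hTD hBpos.le)
    _ = Real.log M := by field_simp

/-- The lower bound for the `ℓ₂` ball. -/
theorem facet_lower_bound_ball2 :
    ∃ ε : ℝ, 0 < ε ∧ ∃ c : ℝ, 0 < c ∧ ∀ n : ℕ, 1 ≤ n → ∀ M : ℕ, ∀ L ∈ Facet n M,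
      distG (ball2 n) L ≤ ε → (2 : ℝ) ^ (c * Real.sqrt n) ≤ M := by
  refine facet_lower_bound (f := fun x => x ^ 2 - 1) (by fun_prop) memLp_sq_sub_one
    integral_sq_sub_one ⟨2, by norm_num⟩ ⟨0, by norm_num⟩ (fun x => by ring) ball2 ?_
    (show (0 : ℝ) < 2 by norm_num) ?_
  · intro n x
    rw [sum_sq_sub_one, ball2, sub_nonpos]
    change ‖x‖ ≤ √(n : ℝ) ↔ _
    exact Real.le_sqrt (norm_nonneg x) (Nat.cast_nonneg n)
  · intro n hn R hR x hx
    have hs0 : 0 < √(n : ℝ) := Real.sqrt_pos.2 (by exact_mod_cast hn)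
    have hss : √(n : ℝ) * √n = n := Real.mul_self_sqrt (Nat.cast_nonneg n)
    have hx' : √(n : ℝ) < Real.exp (-(R / √n)) * ‖x‖ := by
      have : √(n : ℝ) < ‖Real.exp (-(R / √n)) • x‖ := not_le.1 hx
      rwa [norm_smul, Real.norm_eq_abs, Real.abs_exp] at this
    have h1 := mul_lt_mul_of_pos_left hx' (Real.exp_pos (R / √n))
    rw [← mul_assoc, ← Real.exp_add, add_neg_cancel, Real.exp_zero, one_mul] at h1
    have h2 : √n + R < ‖x‖ := by
      refine lt_of_le_of_lt ?_ h1
      have := mul_le_mul_of_nonneg_right (Real.add_one_le_exp (R / √n)) hs0.le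
      rwa [add_mul, div_mul_cancel₀ _ hs0.ne', one_mul, add_comm] at this
    rw [sum_sq_sub_one]
    nlinarith

/-- The lower bound for the cross-polytope. -/
theorem facet_lower_bound_ball1 :
    ∃ ε : ℝ, 0 < ε ∧ ∃ c : ℝ, 0 < c ∧ ∀ n : ℕ, 1 ≤ n → ∀ M : ℕ, ∀ L ∈ Facet n M,
      distG (ball1 n) L ≤ ε → (2 : ℝ) ^ (c * Real.sqrt n) ≤ M := by
  have hμ : 0 < √(2 / Real.pi) := Real.sqrt_pos.2 (by positivity)
  have hsum : ∀ (n : ℕ) (x : EuclideanSpace ℝ (Fin n)),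
      ∑ i, (|x i| - √(2 / Real.pi)) = ∑ i, |x i| - √(2 / Real.pi) * n := by
    intro n x
    simp [mul_comm]
  refine facet_lower_bound (f := fun x => |x| - √(2 / Real.pi)) (by fun_prop) memLp_abs_sub
    integral_abs_sub ⟨√(2 / Real.pi) + 1, ?_⟩ ⟨0, by simpa using hμ⟩ (fun x => by simp) ball1 ?_
    hμ ?_
  · rw [abs_of_pos (by positivity)]
    linarith
  · intro n x
    rw [hsum, sub_nonpos]
    rfl
  · intro n hn R hR x hx
    have hs0 : 0 < √(n : ℝ) := Real.sqrt_pos.2 (by exact_mod_cast hn)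
    have hss : √(n : ℝ) * √n = n := Real.mul_self_sqrt (Nat.cast_nonneg n)
    have hx' : √(2 / Real.pi) * n < Real.exp (-(R / √n)) * ∑ i, |x i| := by
      have : √(2 / Real.pi) * n < ∑ i, |(Real.exp (-(R / √n)) • x) i| := not_le.1 hx
      simpa [abs_mul, Finset.mul_sum] using this
    have h1 := mul_lt_mul_of_pos_left hx' (Real.exp_pos (R / √n))
    rw [← mul_assoc (Real.exp _) (Real.exp _), ← Real.exp_add, add_neg_cancel, Real.exp_zero,
      one_mul] at h1
    have h2 := mul_le_mul_of_nonneg_right (Real.add_one_le_exp (R / √n))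
      (show 0 ≤ √(2 / Real.pi) * n by positivity)
    have h3 : R / √n * (√(2 / Real.pi) * n) = √(2 / Real.pi) * R * √n := by
      field_simp
      rw [sq, hss]
    rw [hsum]
    linarith

/-! ### Approximation of the ball by random polytopes -/

/-- A thin shell around the sphere of radius `√n` has small mass, uniformly in `n`: it has `K`
disjoint dilates of comparable mass. -/
theorem stdGaussian_shell_le {n : ℕ} (hn : 1 ≤ n) {K : ℕ} (hK : 1 ≤ K) {b : ℝ}
    (hb : b = 1 / (4 * K * √n)) :
    (stdGaussian (EuclideanSpace ℝ (Fin n))).real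
      {x | Real.exp (-b) * √n ≤ ‖x‖ ∧ ‖x‖ < Real.exp b * √n} ≤ Real.exp (3 / 2) / K := by
  set γ := stdGaussian (EuclideanSpace ℝ (Fin n))
  set s := √(n : ℝ) with hs
  have hs1 : 1 ≤ s := by rw [hs, Real.one_le_sqrt]; exact_mod_cast hn
  have hs0 : 0 < s := by linarith
  have hss : s ^ 2 = n := Real.sq_sqrt (Nat.cast_nonneg n)
  have hK1 : (1 : ℝ) ≤ K := by exact_mod_cast hK
  have hb0 : 0 < b := by rw [hb]; positivity
  have hKb : K * (2 * b) * s = 1 / 2 := by rw [hb]; field_simp; norm_num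
  have h2b : 2 * b * s ≤ 1 / 2 := by nlinarith [mul_pos hb0 hs0]
  set A : Set (EuclideanSpace ℝ (Fin n)) :=
    {x | Real.exp (-b) * s ≤ ‖x‖ ∧ ‖x‖ < Real.exp b * s} with hA
  have hAm : MeasurableSet A := measurable_norm measurableSet_Ico
  let F : ℕ → Set (EuclideanSpace ℝ (Fin n)) := fun k => {y | Real.exp (-(k * (2 * b))) • y ∈ A}
  have hFm : ∀ k, MeasurableSet (F k) := fun k => (measurable_const_smul _) hAm
  have hexp : ∀ z : ℝ, 0 ≤ z → z ≤ 1 → Real.exp z ≤ 1 + z + z ^ 2 := by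
    intro z h0 h1
    have := (abs_le.1 (Real.abs_exp_sub_one_sub_id_le (by rwa [abs_of_nonneg h0]))).2
    linarith
  have h1 : ∀ k ∈ Finset.range K, Real.exp (-(3 / 2)) * γ.real A ≤ γ.real (F k) := by
    intro k hk
    refine mul_measureReal_le_of_density hAm (Real.exp_pos _).le
      (stdGaussian_dilate hAm _) fun x hx => Real.exp_le_exp.2 ?_
    rw [finrank_euclideanSpace_fin, ← hss]
    have hkK : (k : ℝ) ≤ K := by exact_mod_cast (Finset.mem_range.1 hk).le
    set w := k * (2 * b) with hw
    have hw0 : 0 ≤ w := by positivity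
    have hws : w * s ≤ 1 / 2 := by
      rw [← hKb, hw]
      gcongr
    have hw1 : w ≤ 1 / 2 := by nlinarith
    have e1 : Real.exp (2 * w) - 1 ≤ 2 * w + 4 * w ^ 2 := by
      linarith [hexp (2 * w) (by linarith) (by linarith)]
    have e2 : ‖x‖ ^ 2 ≤ s ^ 2 + s := by
      have e3 : ‖x‖ ^ 2 ≤ Real.exp (2 * b) * s ^ 2 := by
        have := pow_le_pow_left₀ (norm_nonneg x) hx.2.le 2
        rw [mul_pow, ← Real.exp_nat_mul] at this
        exact_mod_cast this
      have e4 := hexp (2 * b) (by linarith) (by nlinarith)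
      have e5 : Real.exp (2 * b) * s ^ 2 ≤ (1 + 2 * b + (2 * b) ^ 2) * s ^ 2 := by gcongr
      nlinarith [mul_pos hb0 hs0]
    have e6 : (Real.exp (2 * w) - 1) * ‖x‖ ^ 2 ≤ (2 * w + 4 * w ^ 2) * (s ^ 2 + s) :=
      mul_le_mul e1 e2 (sq_nonneg _) (by positivity)
    have e7 : (w * s) ^ 2 ≤ 1 / 4 := by nlinarith [mul_nonneg hw0 hs0.le]
    have e8 : w ^ 2 * s ≤ (w * s) ^ 2 := by nlinarith [mul_nonneg (sq_nonneg w) hs0.le]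
    nlinarith
  have h2 : ∑ k ∈ Finset.range K, γ.real (F k) ≤ 1 := by
    rw [← measureReal_biUnion_finset ?_ fun k _ => hFm k]
    · exact measureReal_le_one
    have key : ∀ k k' : ℕ, k < k' → Disjoint (F k) (F k') := by
      intro k k' hkk
      refine Set.disjoint_left.2 fun y hy hy' => ?_
      have a1 : ‖Real.exp (-(k * (2 * b))) • y‖ < Real.exp b * s := hy.2
      have a2 : Real.exp (-b) * s ≤ ‖Real.exp (-(k' * (2 * b))) • y‖ := hy'.1
      rw [norm_smul, Real.norm_eq_abs, Real.abs_exp] at a1 a2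
      have hk1 : (k : ℝ) + 1 ≤ k' := by exact_mod_cast hkk
      have a3 : Real.exp (-(k' * (2 * b))) ≤ Real.exp (-(2 * b)) * Real.exp (-(k * (2 * b))) := by
        rw [← Real.exp_add]
        exact Real.exp_le_exp.2 (by nlinarith)
      have a4 : Real.exp (-b) * s < Real.exp (-(2 * b)) * (Real.exp b * s) :=
        calc Real.exp (-b) * s ≤ Real.exp (-(k' * (2 * b))) * ‖y‖ := a2
          _ ≤ Real.exp (-(2 * b)) * Real.exp (-(k * (2 * b))) * ‖y‖ := by gcongr
          _ = Real.exp (-(2 * b)) * (Real.exp (-(k * (2 * b))) * ‖y‖) := mul_assoc _ _ _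
          _ < _ := by gcongr
      rw [← mul_assoc, ← Real.exp_add] at a4
      exact absurd a4 (not_lt.2 (le_of_eq (by congr 2; ring)))
    intro k _ k' _ hne
    rcases lt_or_gt_of_ne hne with h | h
    · exact key k k' h
    · exact (key k' k h).symm
  have h3 := Finset.card_nsmul_le_sum (Finset.range K) (fun k => γ.real (F k)) _ h1
  rw [Finset.card_range, nsmul_eq_mul] at h3
  have h4 : Real.exp (3 / 2) * Real.exp (-(3 / 2)) = 1 := by rw [← Real.exp_add]; simp
  rw [le_div_iff₀ (by linarith)]
  calc γ.real A * K = Real.exp (3 / 2) * (K * (Real.exp (-(3 / 2)) * γ.real A)) := by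
        linear_combination -(K * γ.real A) * h4
    _ ≤ Real.exp (3 / 2) * 1 := by
        gcongr
        linarith
    _ = _ := mul_one _

section Tail

/-- The upper tail `P(N > u)` of a standard normal variable. -/
noncomputable def normalTail (u : ℝ) : ℝ := (stdGaussian ℝ).real (Set.Ioi u)

lemma normalTail_anti {u u' : ℝ} (h : u ≤ u') : normalTail u' ≤ normalTail u :=
  measureReal_mono (Set.Ioi_subset_Ioi h) (measure_ne_top _ _)

lemma normalTail_le_one (u : ℝ) : normalTail u ≤ 1 := measureReal_le_one

lemma normalTail_pos (u : ℝ) : 0 < normalTail u :=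
  ENNReal.toReal_pos (isOpen_Ioi.measure_ne_zero _ ⟨u + 1, by simp⟩) (measure_ne_top _ _)

/-- The tail decreases under dilation of the threshold by a factor comparable to the ratio of the
densities, with no polynomial loss. -/
lemma normalTail_exp_mul_le {u s : ℝ} (hu : 0 ≤ u) (hs : 0 ≤ s) :
    normalTail (Real.exp s * u) ≤
      Real.exp (s - (Real.exp (2 * s) - 1) * u ^ 2 / 2) * normalTail u := by
  have hset : Set.Ioi (Real.exp s * u) = {y | Real.exp (-s) • y ∈ Set.Ioi u} := by
    ext y
    change _ < y ↔ u < Real.exp (-s) * y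
    rw [Real.exp_neg, inv_mul_eq_div, lt_div_iff₀ (Real.exp_pos s), mul_comm]
  rw [normalTail, hset]
  refine measureReal_le_mul_of_density measurableSet_Ioi (Real.exp_pos _).le
    (stdGaussian_dilate measurableSet_Ioi s) fun x hx => Real.exp_le_exp.2 ?_
  have hx' : u < x := hx
  have h1 : u ^ 2 ≤ x ^ 2 := pow_le_pow_left₀ hu hx'.le 2
  have h2 : 0 ≤ Real.exp (2 * s) - 1 := by linarith [Real.add_one_le_exp (2 * s)]
  rw [Real.norm_eq_abs, sq_abs, Module.finrank_self]
  push_cast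
  linarith [mul_le_mul_of_nonneg_left h1 h2]

lemma exists_le_normalTail : ∃ κ : ℝ, 0 < κ ∧ ∀ u : ℝ, 0 ≤ u →
    κ * Real.exp (-(1 / 2 + u ^ 2)) ≤ normalTail u := by
  refine ⟨(stdGaussian ℝ).real (Set.Ioo 0 1), ENNReal.toReal_pos
    (isOpen_Ioo.measure_ne_zero _ ⟨1 / 2, by norm_num⟩) (measure_ne_top _ _), fun u hu => ?_⟩
  rw [mul_comm]
  refine (mul_measureReal_le_of_density (ν := stdGaussian ℝ) measurableSet_Ioo (Real.exp_pos _).le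
    (stdGaussian_translate measurableSet_Ioo u) fun x hx => Real.exp_le_exp.2 ?_).trans
    (measureReal_mono ?_ (measure_ne_top _ _))
  · have h1 : u * x ≤ u * 1 := mul_le_mul_of_nonneg_left hx.2.le hu
    have h2 : inner ℝ x u = u * x := by simp
    rw [h2, Real.norm_eq_abs, sq_abs]
    nlinarith [sq_nonneg (u - 1)]
  · intro y hy
    have : 0 < y - u := hy.1
    exact sub_pos.1 this

variable {E : Type*} [NormedAddCommGroup E] [InnerProductSpace ℝ E]
  [FiniteDimensional ℝ E] [MeasurableSpace E] [BorelSpace E]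

/-- One-dimensional marginals of the standard Gaussian measure are standard normal. -/
lemma stdGaussian_map_inner {u : E} (hu : ‖u‖ = 1) :
    (stdGaussian E).map (fun v => inner ℝ v u) = stdGaussian ℝ := by
  have := Measure.isProbabilityMeasure_map (μ := stdGaussian E) (f := fun v => inner ℝ v u)
    (by fun_prop)
  apply Measure.ext_of_charFun
  ext t
  rw [charFun_stdGaussian, charFun_apply, integral_map (by fun_prop)
    (Measurable.aestronglyMeasurable (by fun_prop))]
  have h := charFun_stdGaussian (E := E) (t • u)
  rw [charFun_apply] at h
  rw [norm_smul, hu, mul_one] at h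
  rw [← h]
  congr 1
  ext v
  simp [inner_smul_right]

lemma stdGaussian_inner_gt {x : E} (hx : x ≠ 0) (θ : ℝ) :
    (stdGaussian E).real {v | θ < inner ℝ x v} = normalTail (θ / ‖x‖) := by
  have hx0 : 0 < ‖x‖ := norm_pos_iff.2 hx
  have hu : ‖(‖x‖⁻¹ • x)‖ = 1 := by
    rw [norm_smul, norm_inv, norm_norm, inv_mul_cancel₀ hx0.ne']
  rw [normalTail, ← stdGaussian_map_inner hu, map_measureReal_apply (by fun_prop) measurableSet_Ioi]
  congr 1
  ext v
  change θ < inner ℝ x v ↔ θ / ‖x‖ < inner ℝ v (‖x‖⁻¹ • x)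
  rw [inner_smul_right, real_inner_comm, inv_mul_eq_div, div_lt_div_iff_of_pos_right hx0]

lemma normalTail_le_stdGaussian_inner_gt {x : E} {r θ : ℝ} (hr : 0 < r) (hθ : 0 ≤ θ)
    (hx : r ≤ ‖x‖) : normalTail (θ / r) ≤ (stdGaussian E).real {v | θ < inner ℝ x v} := by
  rw [stdGaussian_inner_gt (norm_pos_iff.1 (hr.trans_le hx))]
  exact normalTail_anti (by gcongr)

lemma stdGaussian_inner_gt_le_normalTail {x : E} {r θ : ℝ} (hθ : 0 ≤ θ)
    (hx : ‖x‖ ≤ r) : (stdGaussian E).real {v | θ < inner ℝ x v} ≤ normalTail (θ / r) := by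
  rcases eq_or_ne x 0 with rfl | h
  · simp [hθ.not_gt, (normalTail_pos _).le]
  · rw [stdGaussian_inner_gt h]
    have := norm_pos_iff.2 h
    exact normalTail_anti (by gcongr)

end Tail

lemma isHalfspace_of_ne_zero {n : ℕ} {v : EuclideanSpace ℝ (Fin n)} (hv : v ≠ 0) (θ : ℝ) :
    IsHalfspace {x | inner ℝ x v ≤ θ} := by
  have hv0 : 0 < ‖v‖ := norm_pos_iff.2 hv
  refine ⟨‖v‖⁻¹ • v, θ / ‖v‖, by rw [norm_smul, norm_inv, norm_norm, inv_mul_cancel₀ hv0.ne'], ?_⟩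
  ext x
  change inner ℝ x v ≤ θ ↔ inner ℝ x (‖v‖⁻¹ • v) ≤ θ / ‖v‖
  rw [inner_smul_right, inv_mul_eq_div, div_le_div_iff_of_pos_right hv0]

/-- **Random polytopes.** If each of `M` independent random halfspaces `{x | ⟪x, v⟫ ≤ θ}`, with
`v` standard Gaussian, rarely cuts off a point of norm less than `r₁ ≤ √n`, while a point of norm at
least `r₂ > √n` is likely to be cut off by one of them, then some intersection of `M` halfspaces is
close to the ball: average over `v` and exchange the order of integration. -/
theorem exists_facet_distG_ball2_le {n M : ℕ} (hn : 1 ≤ n) {θ r₁ r₂ η α : ℝ} (hη : 0 ≤ η)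
    (hr₁ : r₁ ≤ √n) (hr₂ : √n < r₂)
    (hshell : (stdGaussian (EuclideanSpace ℝ (Fin n))).real {x | r₁ ≤ ‖x‖ ∧ ‖x‖ < r₂} ≤ α)
    (hin : ∀ x : EuclideanSpace ℝ (Fin n), ‖x‖ < r₁ →
      M * (stdGaussian (EuclideanSpace ℝ (Fin n))).real {v | θ < inner ℝ x v} ≤ η)
    (hout : ∀ x : EuclideanSpace ℝ (Fin n), r₂ ≤ ‖x‖ →
      (1 - (stdGaussian (EuclideanSpace ℝ (Fin n))).real {v | θ < inner ℝ x v}) ^ M ≤ η) :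
    ∃ L ∈ Facet n M, distG (ball2 n) L ≤ η + α := by
  set E := EuclideanSpace ℝ (Fin n)
  set γ := stdGaussian E
  set μ := Measure.pi fun _ : Fin M => γ
  have hα : 0 ≤ α := measureReal_nonneg.trans hshell
  let L : (Fin M → E) → Set E := fun v => ⋂ i, {x | inner ℝ x (v i) ≤ θ}
  have hmemL : ∀ v x, x ∈ L v ↔ ∀ i, inner ℝ x (v i) ≤ θ := fun v x => by simp [L]
  let S : Set ((Fin M → E) × E) := {p | p.2 ∈ symmDiff (ball2 n) (L p.1)}
  have hSm : MeasurableSet S := by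
    have h1 : MeasurableSet {p : (Fin M → E) × E | p.2 ∈ ball2 n} :=
      measurableSet_le measurable_snd.norm measurable_const
    have h2 : MeasurableSet {p : (Fin M → E) × E | p.2 ∈ L p.1} := by
      have : {p : (Fin M → E) × E | p.2 ∈ L p.1} =
          ⋂ i, {p : (Fin M → E) × E | inner ℝ p.2 (p.1 i) ≤ θ} := by
        ext p
        simp [hmemL]
      rw [this]
      exact MeasurableSet.iInter fun i => measurableSet_le (by fun_prop) (by fun_prop)
    exact h1.symmDiff h2
  have hcutm : ∀ x : E, MeasurableSet {v : E | θ < inner ℝ x v} := fun x =>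
    measurableSet_lt (by fun_prop) (by fun_prop)
  -- the probability over `v` that a fixed point lies in the symmetric difference
  have hslice : ∀ x : E, μ {v | (v, x) ∈ S} ≤
      ENNReal.ofReal η + {x : E | r₁ ≤ ‖x‖ ∧ ‖x‖ < r₂}.indicator 1 x := by
    intro x
    by_cases hx : r₁ ≤ ‖x‖ ∧ ‖x‖ < r₂
    · rw [Set.indicator_of_mem (show x ∈ {x : E | r₁ ≤ ‖x‖ ∧ ‖x‖ < r₂} from hx), Pi.one_apply]
      exact prob_le_one.trans le_add_self
    refine le_trans ?_ le_self_add
    rcases lt_or_ge ‖x‖ r₁ with h | h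
    · have hxB : x ∈ ball2 n := (h.trans_le hr₁).le
      have hsub : {v | (v, x) ∈ S} ⊆ ⋃ i, (fun v : Fin M → E => v i) ⁻¹' {v | θ < inner ℝ x v} := by
        intro v hv
        have hv' : x ∉ L v := by
          rcases hv with h' | h'
          · exact h'.2
          · exact absurd hxB h'.2
        rw [hmemL] at hv'
        push Not at hv'
        exact Set.mem_iUnion.2 hv'
      refine (measure_mono hsub).trans ((measure_iUnion_fintype_le _ _).trans ?_)
      have hev : ∀ i : Fin M, μ ((fun v : Fin M → E => v i) ⁻¹' {v | θ < inner ℝ x v}) =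
          γ {v | θ < inner ℝ x v} := fun i =>
        (measurePreserving_eval (fun _ : Fin M => γ) i).measure_preimage (hcutm x).nullMeasurableSet
      simp only [hev, Finset.sum_const, Finset.card_univ, Fintype.card_fin, nsmul_eq_mul]
      rw [ENNReal.le_ofReal_iff_toReal_le (ENNReal.mul_ne_top (by simp) (measure_ne_top _ _)) hη,
        ENNReal.toReal_mul, ENNReal.toReal_natCast]
      exact hin x h
    · have h2 : r₂ ≤ ‖x‖ := not_lt.1 fun h' => hx ⟨h, h'⟩
      have hxB : x ∉ ball2 n := not_le.2 (hr₂.trans_le h2)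
      have hsub : {v | (v, x) ∈ S} ⊆
          Set.pi Set.univ fun _ : Fin M => {v : E | θ < inner ℝ x v}ᶜ := by
        intro v hv
        have hv' : x ∈ L v := by
          rcases hv with h' | h'
          · exact absurd h'.1 hxB
          · exact h'.1
        rw [hmemL] at hv'
        intro i _
        exact not_lt.2 (hv' i)
      refine (measure_mono hsub).trans ?_
      rw [Measure.pi_pi, Finset.prod_const, Finset.card_univ, Fintype.card_fin,
        ENNReal.le_ofReal_iff_toReal_le (ENNReal.pow_ne_top (measure_ne_top _ _)) hη,
        ENNReal.toReal_pow, ← measureReal_def, probReal_compl_eq_one_sub (hcutm x)]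
      exact hout x h2
  have hshellm : MeasurableSet {x : E | r₁ ≤ ‖x‖ ∧ ‖x‖ < r₂} :=
    measurable_norm measurableSet_Ico
  have htotal : ∫⁻ v, γ (symmDiff (ball2 n) (L v)) ∂μ ≤ ENNReal.ofReal (η + α) :=
    calc ∫⁻ v, γ (symmDiff (ball2 n) (L v)) ∂μ = (μ.prod γ) S := (Measure.prod_apply hSm).symm
      _ = ∫⁻ x, μ {v | (v, x) ∈ S} ∂γ := Measure.prod_apply_symm hSm
      _ ≤ ∫⁻ x, (ENNReal.ofReal η + {x : E | r₁ ≤ ‖x‖ ∧ ‖x‖ < r₂}.indicator 1 x) ∂γ :=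
          lintegral_mono hslice
      _ = ENNReal.ofReal η + γ {x : E | r₁ ≤ ‖x‖ ∧ ‖x‖ < r₂} := by
          rw [lintegral_add_left measurable_const, lintegral_indicator_one hshellm]
          simp
      _ ≤ ENNReal.ofReal η + ENNReal.ofReal α := by
          gcongr
          exact (ENNReal.le_ofReal_iff_toReal_le (measure_ne_top _ _) hα).2 hshell
      _ = _ := (ENNReal.ofReal_add hη hα).symm
  -- the normals are almost surely nonzero
  have hnull : μ {v | ∃ i, v i = 0} = 0 := by
    have : Nontrivial E := by
      have : NeZero n := ⟨by omega⟩
      infer_instance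
    have hγ0 : γ {0} = 0 := by
      have hac : γ ≪ volume := by
        rw [show γ = _ from stdGaussian_eq_withDensity]
        exact withDensity_absolutelyContinuous _ _
      exact hac (measure_singleton 0)
    have : {v : Fin M → E | ∃ i, v i = 0} = ⋃ i, (fun v : Fin M → E => v i) ⁻¹' {0} := by
      ext v
      simp
    rw [this, measure_iUnion_null_iff]
    intro i
    rw [(measurePreserving_eval (fun _ : Fin M => γ) i).measure_preimage
      (measurableSet_singleton 0).nullMeasurableSet, hγ0]
  obtain ⟨v, hv, hvle⟩ := exists_notMem_null_le_lintegral (μ := μ)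
    (f := fun v => γ (symmDiff (ball2 n) (L v))) (measurable_measure_prodMk_left hSm).aemeasurable
    hnull
  refine ⟨L v, ⟨fun i => {x | inner ℝ x (v i) ≤ θ}, fun i => isHalfspace_of_ne_zero
    (fun h => hv ⟨i, h⟩) θ, rfl⟩, ?_⟩
  exact ENNReal.toReal_le_of_le_ofReal (by positivity) (hvle.trans htotal)

/-- The ball is approximated to any constant accuracy by `2 ^ O(√n)` halfspaces. Writing
`r₁ < √n < r₂` for the radii of a thin shell, the threshold is `θ = u r₂` with `u ^ 2 = A √n`: a
point at radius `r₁` is then cut off less likely than one at radius `r₂` by a factor that is small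
when `A` is large. -/
theorem facet_upper_bound_ball2 {δ : ℝ} (hδ : 0 < δ) :
    ∃ C : ℝ, 0 < C ∧ ∀ n : ℕ, 1 ≤ n → ∃ M : ℕ, (M : ℝ) ≤ (2 : ℝ) ^ (C * Real.sqrt n) ∧
      ∃ L ∈ Facet n M, distG (ball2 n) L ≤ δ := by
  obtain ⟨κ, hκ, htail⟩ := exists_le_normalTail
  obtain ⟨K, hK⟩ := exists_nat_gt (Real.exp (3 / 2) / (δ / 2))
  have hK0 : (0 : ℝ) < K := lt_trans (by positivity) hK
  have hK1 : 1 ≤ K := by exact_mod_cast hK0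
  have hK1' : (1 : ℝ) ≤ K := by exact_mod_cast hK1
  have hshell : Real.exp (3 / 2) / K ≤ δ / 2 := by
    rw [div_lt_iff₀ (by positivity)] at hK
    rw [div_le_iff₀ hK0]
    linarith
  -- `Λ` is the expected number of halfspaces that cut off a point at radius `r₂`
  set Λ := |Real.log (δ / 2)| + 1 with hΛ
  have hΛ0 : 0 < Λ := by positivity
  have hexpΛ : Real.exp (-Λ) ≤ δ / 2 := by
    calc Real.exp (-Λ) ≤ Real.exp (Real.log (δ / 2)) :=
          Real.exp_le_exp.2 (by linarith [neg_abs_le (Real.log (δ / 2))])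
      _ = δ / 2 := Real.exp_log (by positivity)
  set A := 2 * K * (1 + Real.log (Λ + 1) + Λ) with hA
  have hlogΛ : 0 ≤ Real.log (Λ + 1) := Real.log_nonneg (by linarith)
  have hA0 : 0 < A := by positivity
  have hAexp : (Λ + 1) * Real.exp (1 - A / (2 * K)) ≤ δ / 2 := by
    have h1 : 1 - A / (2 * K) = -Real.log (Λ + 1) + -Λ := by
      rw [hA]
      field_simp
      ring
    rw [h1, Real.exp_add, Real.exp_neg, Real.exp_log (by positivity), ← mul_assoc,
      mul_inv_cancel₀ (by positivity), one_mul]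
    exact hexpΛ
  have hlog2 : 0 < Real.log 2 := Real.log_pos (by norm_num)
  have hlogκ : 0 ≤ Real.log (Λ / κ + 1) :=
    Real.log_nonneg (by linarith [div_pos hΛ0 hκ])
  refine ⟨(Real.log (Λ / κ + 1) + 1 / 2 + A) / Real.log 2, by positivity, fun n hn => ?_⟩
  have hs1 : 1 ≤ √(n : ℝ) := by rw [Real.one_le_sqrt]; exact_mod_cast hn
  set s := √(n : ℝ) with hs
  have hs0 : 0 < s := by linarith
  set b := 1 / (4 * K * s) with hb
  have hb0 : 0 < b := by positivity
  have hbs : b * s = 1 / (4 * K) := by rw [hb]; field_simp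
  have hb2 : 2 * b ≤ 1 := by
    have : b ≤ 1 / 4 := by
      rw [hb]
      refine one_div_le_one_div_of_le (by norm_num) ?_
      nlinarith
    linarith
  set u := √(A * s) with hu
  have hu0 : 0 ≤ u := Real.sqrt_nonneg _
  have hu2 : u ^ 2 = A * s := Real.sq_sqrt (by positivity)
  set r₁ := Real.exp (-b) * s with hr₁
  set r₂ := Real.exp b * s with hr₂
  have hr₁0 : 0 < r₁ := by positivity
  have hr₂0 : 0 < r₂ := by positivity
  set p := normalTail u with hp
  have hp0 : 0 < p := normalTail_pos u
  have hp1 : p ≤ 1 := normalTail_le_one u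
  have hratio : normalTail (u * r₂ / r₁) ≤ Real.exp (1 - A / (2 * K)) * p := by
    have h1 : u * r₂ / r₁ = Real.exp (2 * b) * u := by
      have h : Real.exp b = Real.exp (2 * b) * Real.exp (-b) := by
        rw [← Real.exp_add]; congr 1; ring
      rw [hr₁, hr₂, h]
      field_simp
    rw [h1]
    refine (normalTail_exp_mul_le hu0 (by positivity)).trans ?_
    refine mul_le_mul_of_nonneg_right (Real.exp_le_exp.2 ?_) hp0.le
    have h2 : 4 * b ≤ Real.exp (2 * (2 * b)) - 1 := by
      linarith [Real.add_one_le_exp (2 * (2 * b))]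
    have h3 : 4 * b * u ^ 2 ≤ (Real.exp (2 * (2 * b)) - 1) * u ^ 2 :=
      mul_le_mul_of_nonneg_right h2 (sq_nonneg u)
    have h4 : 4 * b * u ^ 2 = A / K := by
      rw [hu2, show 4 * b * (A * s) = 4 * A * (b * s) by ring, hbs]
      field_simp
    have h5 : A / (2 * K) = A / K / 2 := by field_simp
    rw [h5]
    linarith
  set M := ⌈Λ / p⌉₊ with hM
  have hMlow : Λ ≤ M * p := by
    rw [← div_le_iff₀ hp0]
    exact Nat.le_ceil _
  have hMup : (M : ℝ) ≤ Λ / p + 1 := (Nat.ceil_lt_add_one (by positivity)).le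
  refine ⟨M, ?_, ?_⟩
  · have h1 : Λ / p ≤ Λ / κ * Real.exp (1 / 2 + A * s) := by
      rw [div_le_iff₀ hp0]
      have h2 := htail u hu0
      rw [hu2, Real.exp_neg] at h2
      calc Λ = Λ / κ * Real.exp (1 / 2 + A * s) * (κ * (Real.exp (1 / 2 + A * s))⁻¹) := by
            field_simp
        _ ≤ _ := by gcongr
    have h3 : 1 ≤ Real.exp (1 / 2 + A * s) := Real.one_le_exp (by positivity)
    calc (M : ℝ) ≤ (Λ / κ + 1) * Real.exp (1 / 2 + A * s) := by linarith
      _ = Real.exp (Real.log (Λ / κ + 1) + (1 / 2 + A * s)) := by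
          rw [Real.exp_add (Real.log _), Real.exp_log (by positivity)]
      _ ≤ Real.exp ((Real.log (Λ / κ + 1) + 1 / 2 + A) * s) := by
          refine Real.exp_le_exp.2 ?_
          nlinarith
      _ = 2 ^ ((Real.log (Λ / κ + 1) + 1 / 2 + A) / Real.log 2 * s) := by
          rw [Real.rpow_def_of_pos (by norm_num)]
          congr 1
          field_simp
  · obtain ⟨L, hL, hd⟩ := exists_facet_distG_ball2_le (M := M) hn (θ := u * r₂)
      (r₁ := r₁) (r₂ := r₂) (η := δ / 2) (α := δ / 2) (by positivity)
      (mul_le_of_le_one_left hs0.le (Real.exp_le_one_iff.2 (by linarith)))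
      (lt_mul_of_one_lt_left hs0 (Real.one_lt_exp_iff.2 hb0))
      ((stdGaussian_shell_le hn hK1 hb).trans hshell)
      (fun x hx => by
        have h1 := (stdGaussian_inner_gt_le_normalTail (by positivity) hx.le).trans hratio
        calc M * (stdGaussian (EuclideanSpace ℝ (Fin n))).real {v | u * r₂ < inner ℝ x v}
            ≤ (Λ / p + 1) * (Real.exp (1 - A / (2 * K)) * p) := by gcongr
          _ = (Λ + p) * Real.exp (1 - A / (2 * K)) := by field_simp
          _ ≤ (Λ + 1) * Real.exp (1 - A / (2 * K)) := by gcongr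
          _ ≤ δ / 2 := hAexp)
      (fun x hx => by
        have h1 := normalTail_le_stdGaussian_inner_gt (θ := u * r₂) hr₂0 (by positivity) hx
        rw [mul_div_cancel_right₀ _ hr₂0.ne'] at h1
        have h2 : (stdGaussian (EuclideanSpace ℝ (Fin n))).real {v | u * r₂ < inner ℝ x v} ≤ 1 :=
          measureReal_le_one
        calc (1 - (stdGaussian (EuclideanSpace ℝ (Fin n))).real {v | u * r₂ < inner ℝ x v}) ^ M
            ≤ (1 - p) ^ M := pow_le_pow_left₀ (by linarith) (by linarith) M
          _ ≤ Real.exp (-p) ^ M := pow_le_pow_left₀ (by linarith) (Real.one_sub_le_exp_neg p) M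
          _ = Real.exp (-(M * p)) := by rw [← Real.exp_nat_mul]; congr 1; ring
          _ ≤ Real.exp (-Λ) := Real.exp_le_exp.2 (by linarith)
          _ ≤ δ / 2 := hexpΛ)
    exact ⟨L, hL, by linarith⟩

end GaussianApprox

theorem theorem9p1 :
    ∃ ε : ℝ, 0 < ε ∧
      -- lower bound for the `ℓ₂` ball
      (∃ c : ℝ, 0 < c ∧ ∀ n : ℕ, 1 ≤ n → ∀ M : ℕ, ∀ L ∈ GaussianApprox.Facet n M,
        GaussianApprox.distG (GaussianApprox.ball2 n) L ≤ ε →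
          (2 : ℝ) ^ (c * Real.sqrt n) ≤ M) ∧
      -- lower bound for the cross-polytope
      (∃ c : ℝ, 0 < c ∧ ∀ n : ℕ, 1 ≤ n → ∀ M : ℕ, ∀ L ∈ GaussianApprox.Facet n M,
        GaussianApprox.distG (GaussianApprox.ball1 n) L ≤ ε →
          (2 : ℝ) ^ (c * Real.sqrt n) ≤ M) ∧
      -- tightness for the `ℓ₂` ball: a matching upper bound at every constant error
      (∀ δ : ℝ, 0 < δ → ∃ C : ℝ, 0 < C ∧ ∀ n : ℕ, 1 ≤ n →
        ∃ M : ℕ, (M : ℝ) ≤ (2 : ℝ) ^ (C * Real.sqrt n) ∧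
          ∃ L ∈ GaussianApprox.Facet n M,
            GaussianApprox.distG (GaussianApprox.ball2 n) L ≤ δ) := by
  obtain ⟨ε₂, hε₂, c₂, hc₂, h₂⟩ := GaussianApprox.facet_lower_bound_ball2
  obtain ⟨ε₁, hε₁, c₁, hc₁, h₁⟩ := GaussianApprox.facet_lower_bound_ball1
  exact ⟨min ε₁ ε₂, lt_min hε₁ hε₂,
    ⟨c₂, hc₂, fun n hn M L hL hd => h₂ n hn M L hL (hd.trans (min_le_right _ _))⟩,
    ⟨c₁, hc₁, fun n hn M L hL hd => h₁ n hn M L hL (hd.trans (min_le_left _ _))⟩,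
    fun _ hδ => GaussianApprox.facet_upper_bound_ball2 hδ⟩
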